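/- Let $k\ge 1$ and $l\ge 3$ be integers with $4\mid k$, and let $$G=\mathbb Z_{2^l}\rtimes D_k=\langle a,u,v \mid a^{2^l}=u^k=v^2=1,\ uau^{-1}=a^{n_1},\ vav=a^{n_2},\ vuv=u^{-1}\rangle,\qquad n_1=2^{l-1}+1,\quad n_2=2^{l-1}-1 .$$ Let $D(G)=(\mathbb C^G)^{\mathrm{cop}}\otimes \mathbb C G$ be the Drinfel'd double of $G$ over $\mathbb C$: the Hopf algebra with basis $p_g\bowtie y$ ($g,y\in G$), product $(p_g\bowtie y)(p_h\bowtie z)=\delta_{g,\,yhy^{-1}}\,p_g\bowtie yz$, coproduct $\Delta(p_g\bowtie y)=\sum_{bc=g}(p_c\bowtie y)\otimes(p_b\bowtie y)$ and counit $\varepsilon(p_g\bowtie y)=\delta_{g,1}$. Let $\Lambda$ be its integral with $\varepsilon(\Lambda)=1$. For a finite-dimensional $D(G)$-module $V$ with character $\chi$ and an integer $m\ge 1$, let $\nu_m(V)=\chi\big(\sum\Lambda_1\Lambda_2\cdots\Lambda_m\big)$ be the $m$-th indicator of $V$. Let $r,i$ be integers with $i$ odd, put $s=a^ru^iv$, and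 let $\rho$ be any irreducible finite-dimensional complex representation of the centralizer $C_G(s)$, on a space $W$, with character $\eta$. For every $t$ in the conjugacy class $\mathrm{class}(s)$ fix $g_t\in G$ with $g_t s g_t^{-1}=t$, and let $V=M(\mathrm{class}(s),\eta)=\bigoplus_{t\in \mathrm{class}(s)} g_t\otimes W$ be the $D(G)$-module on which $y\in G$ acts by $y(g_t\otimes w)=g_{yty^{-1}}\otimes\rho\big(g_{yty^{-1}}^{-1}\,y\,g_t\big)w$ and $p_g$ acts as the projection onto the summand $t=g$ (as $0$ if $g\notin\mathrm{class}(s)$). Then $V$ is an irreducible $D(G)$-module of dimension $2^{l-2}k$, and for every integer $m\ge 1$ $$\nu_m(V)=\begin{cases}\tfrac14\gcd(m,k)\gcd(m,2^l) & \text{if } 2\mid m,\\ 0 & \text{if } 2\nmid m.\end{cases}$$ In particular, $\nu_2(V)=1$. -/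

import Mathlib

open scoped TensorProduct

/-! ## Indicators over a Hopf algebra -/

section Indicators

/-- `Λ` is a (two-sided) integral of the Hopf algebra `H` with `ε(Λ) = 1`. -/
def IsNormalizedIntegral {H : Type*} [Ring H] [HopfAlgebra ℂ H] (Λ : H) : Prop :=
  (∀ h : H, h * Λ = Coalgebra.counit (R := ℂ) h • Λ) ∧
  (∀ h : H, Λ * h = Coalgebra.counit (R := ℂ) h • Λ) ∧
  Coalgebra.counit (R := ℂ) Λ = 1

/-- The Sweedler power `h ↦ h^[m] = ∑ h₁ h₂ ⋯ hₘ`, with `h^[0] = ε(h) 1` and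
`h^[m+1] = ∑ h₁ (h₂)^[m]`. -/
noncomputable def sweedlerPow (H : Type*) [Ring H] [HopfAlgebra ℂ H] : ℕ → H →ₗ[ℂ] H
  | 0 => Algebra.linearMap ℂ H ∘ₗ Coalgebra.counit
  | m + 1 => LinearMap.mul' ℂ H ∘ₗ (sweedlerPow H m).lTensor H ∘ₗ Coalgebra.comul

/-- The character of an `H`-module `V`: `χ(h)` is the trace of the action of `h` on `V`. -/
noncomputable def moduleChar (H V : Type*) [Ring H] [HopfAlgebra ℂ H] [AddCommGroup V]
    [Module ℂ V] [Module H V] [IsScalarTower ℂ H V] (h : H) : ℂ :=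
  LinearMap.trace ℂ V (Algebra.lsmul ℂ ℂ V h)

/-- The `m`-th Frobenius–Schur indicator `ν_m(V) = χ(Λ^[m])`, computed with the integral `Λ`. -/
noncomputable def indicator {H : Type*} [Ring H] [HopfAlgebra ℂ H] (Λ : H) (V : Type*)
    [AddCommGroup V] [Module ℂ V] [Module H V] [IsScalarTower ℂ H V] (m : ℕ) : ℂ :=
  moduleChar H V (sweedlerPow H m Λ)

theorem IsNormalizedIntegral.unique {H : Type*} [Ring H] [HopfAlgebra ℂ H] {Λ Λ' : H}
    (h : IsNormalizedIntegral Λ) (h' : IsNormalizedIntegral Λ') : Λ = Λ' := by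
  have h1 := h.2.1 Λ'
  have h2 := h'.1 Λ
  rw [h'.2.2, one_smul] at h1
  rw [h.2.2, one_smul] at h2
  rw [← h1, h2]

end Indicators

/-! ## The Drinfel'd double of a finite group -/

/-- The underlying space of the Drinfel'd double `D(G) = (ℂ^G)^cop ⊗ ℂG`: the complex vector space
with basis the elements `p_g ⋈ y`, indexed by `(g, y) : G × G`. -/
def DrinfeldDouble (G : Type*) : Type _ := (G × G) →₀ ℂ

namespace DrinfeldDouble

section

variable {G : Type*}

noncomputable instance : AddCommGroup (DrinfeldDouble G) :=
  inferInstanceAs (AddCommGroup ((G × G) →₀ ℂ))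

noncomputable instance : Module ℂ (DrinfeldDouble G) :=
  inferInstanceAs (Module ℂ ((G × G) →₀ ℂ))

/-- The basis element `p_g ⋈ y`. -/
noncomputable def e (g y : G) : DrinfeldDouble G := Finsupp.single (g, y) (1 : ℂ)

/-- The linear map with prescribed values `f g y` on the basis elements `p_g ⋈ y`. -/
noncomputable def lift {M : Type*} [AddCommGroup M] [Module ℂ M] (f : G → G → M) :
    DrinfeldDouble G →ₗ[ℂ] M :=
  Finsupp.linearCombination ℂ (fun p : G × G => f p.1 p.2)

@[simp] theorem lift_e {M : Type*} [AddCommGroup M] [Module ℂ M] (f : G → G → M) (g y : G) :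
    lift f (e g y) = f g y := by
  refine (Finsupp.linearCombination_single ℂ (1 : ℂ) ((g, y) : G × G)).trans ?_
  simp

theorem hom_ext {M : Type*} [AddCommGroup M] [Module ℂ M] {f f' : DrinfeldDouble G →ₗ[ℂ] M}
    (h : ∀ g y, f (e g y) = f' (e g y)) : f = f' := by
  refine Finsupp.lhom_ext' (fun p => LinearMap.ext_ring ?_)
  exact h p.1 p.2

theorem ind {P : DrinfeldDouble G → Prop} (a : DrinfeldDouble G)
    (he : ∀ g y, P (e g y)) (hz : P 0) (hadd : ∀ a b, P a → P b → P (a + b))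
    (hsmul : ∀ (c : ℂ) (a), P a → P (c • a)) : P a := by
  refine Finsupp.induction_linear (motive := P) a hz hadd ?_
  intro p c
  have : (Finsupp.single p c : (G × G) →₀ ℂ) = c • (e p.1 p.2 : DrinfeldDouble G) := by
    refine Eq.trans ?_ (Finsupp.smul_single c (p.1, p.2) (1 : ℂ)).symm
    simp
  rw [this]
  exact hsmul c _ (he _ _)

end

section

variable {G : Type*} [Group G]

open Classical in
/-- The product, given on the basis by
`(p_g ⋈ y)(p_h ⋈ z) = p_g p_{y h y⁻¹} ⋈ yz`, which is `p_g ⋈ yz` if `g = y h y⁻¹` and `0` else. -/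
noncomputable def mulMap : DrinfeldDouble G →ₗ[ℂ] DrinfeldDouble G →ₗ[ℂ] DrinfeldDouble G :=
  lift fun g y => lift fun h z => if g = y * h * y⁻¹ then e g (y * z) else 0

noncomputable instance : Mul (DrinfeldDouble G) := ⟨fun a b => mulMap a b⟩

theorem mul_def (a b : DrinfeldDouble G) : a * b = mulMap a b := rfl

open Classical in
theorem e_mul_e (g y h z : G) :
    e g y * e h z = if g = y * h * y⁻¹ then e g (y * z) else 0 := by
  rw [mul_def]; simp [mulMap]

noncomputable instance : NonUnitalNonAssocRing (DrinfeldDouble G) where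
  left_distrib a b c := by simp [mul_def]
  right_distrib a b c := by simp [mul_def]
  zero_mul a := by simp [mul_def]
  mul_zero a := by simp [mul_def]

theorem smul_mul' (c : ℂ) (a b : DrinfeldDouble G) : c • a * b = c • (a * b) := by
  simp [mul_def]

theorem mul_smul' (c : ℂ) (a b : DrinfeldDouble G) : a * c • b = c • (a * b) := by
  simp [mul_def]

theorem mul_assoc' (a b c : DrinfeldDouble G) : a * b * c = a * (b * c) := by
  induction a using ind with
  | hz => simp
  | hadd _ _ h h' => simp [add_mul, h, h']
  | hsmul r _ h => simp [smul_mul', h]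
  | he g x =>
  induction b using ind with
  | hz => simp
  | hadd _ _ h h' => simp [add_mul, mul_add, h, h']
  | hsmul r _ h => simp [smul_mul', mul_smul', h]
  | he h y =>
  induction c using ind with
  | hz => simp
  | hadd _ _ h h' => simp [mul_add, h, h']
  | hsmul r _ h => simp [mul_smul', h]
  | he k z =>
  simp only [e_mul_e]
  by_cases h1 : g = x * h * x⁻¹ <;> by_cases h2 : h = y * k * y⁻¹
  · subst h2; subst h1
    simp [e_mul_e, mul_assoc]
  · have : ¬ x * h * x⁻¹ = x * y * k * (x * y)⁻¹ := by
      intro h3; apply h2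
      have := congrArg (fun t => x⁻¹ * t * x) h3
      simpa [mul_assoc] using this
    rw [if_pos h1, if_neg h2, e_mul_e, if_neg (h1 ▸ this), mul_zero]
  · simp [h1, ← h2, e_mul_e]
  · simp [h1, h2]

end

section

variable {G : Type*} [Group G] [Fintype G]

/-- The unit `∑_g p_g ⋈ 1`. -/
noncomputable instance : One (DrinfeldDouble G) := ⟨∑ g, e g 1⟩

theorem one_def : (1 : DrinfeldDouble G) = ∑ g, e g 1 := rfl

theorem one_mul' (a : DrinfeldDouble G) : 1 * a = a := by
  induction a using ind with
  | hz => simp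
  | hadd _ _ h h' => simp [mul_add, h, h']
  | hsmul r _ h => simp [mul_smul', h]
  | he g x =>
  classical simp [one_def, Finset.sum_mul, e_mul_e]

theorem mul_one' (a : DrinfeldDouble G) : a * 1 = a := by
  induction a using ind with
  | hz => simp
  | hadd _ _ h h' => simp [add_mul, h, h']
  | hsmul r _ h => simp [smul_mul', h]
  | he g x =>
  have : ∀ h : G, (g = x * h * x⁻¹) ↔ (h = x⁻¹ * g * x) := by
    intro h; constructor <;> rintro rfl <;> group
  classical simp [one_def, Finset.mul_sum, e_mul_e, this]

noncomputable instance : Ring (DrinfeldDouble G) where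
  __ := (inferInstance : NonUnitalNonAssocRing (DrinfeldDouble G))
  mul_assoc := mul_assoc'
  one_mul := one_mul'
  mul_one := mul_one'

noncomputable instance : Algebra ℂ (DrinfeldDouble G) :=
  Algebra.ofModule smul_mul' mul_smul'

open Classical in
/-- The coproduct `Δ(p_g ⋈ y) = ∑_{a b = g} (p_b ⋈ y) ⊗ (p_a ⋈ y)` and the counit
`ε(p_g ⋈ y) = δ_{g,1}`: the tensor product of the coalgebras `(ℂ^G)^cop` and `ℂG`. -/
noncomputable instance : CoalgebraStruct ℂ (DrinfeldDouble G) where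
  comul := lift fun g y => ∑ b, e b y ⊗ₜ[ℂ] e (g * b⁻¹) y
  counit := lift fun g _ => if g = 1 then 1 else 0

theorem comul_e (g y : G) : Coalgebra.comul (R := ℂ) (e g y) =
    ∑ b, e b y ⊗ₜ[ℂ] e (g * b⁻¹) y := lift_e _ _ _

open Classical in
theorem counit_e (g y : G) : Coalgebra.counit (R := ℂ) (e g y) = if g = 1 then 1 else 0 :=
  lift_e _ _ _

noncomputable instance : Coalgebra ℂ (DrinfeldDouble G) where
  coassoc := by
    refine hom_ext fun g y => ?_
    simp only [LinearMap.comp_apply, comul_e, map_sum, LinearMap.rTensor_tmul,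
      LinearMap.lTensor_tmul, TensorProduct.sum_tmul, TensorProduct.tmul_sum,
      LinearEquiv.coe_coe, TensorProduct.assoc_tmul]
    rw [Finset.sum_comm]
    refine Finset.sum_congr rfl fun c _ => ?_
    refine Fintype.sum_equiv (Equiv.mulRight c⁻¹) _ _ fun b => ?_
    simp [mul_assoc]
  rTensor_counit_comp_comul := by
    refine hom_ext fun g y => ?_
    classical simp [comul_e, counit_e, TensorProduct.ite_tmul]
  lTensor_counit_comp_comul := by
    refine hom_ext fun g y => ?_
    classical simp [comul_e, counit_e, TensorProduct.tmul_ite, mul_inv_eq_one]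

theorem counit_mul' (a b : DrinfeldDouble G) : Coalgebra.counit (R := ℂ) (a * b) =
    Coalgebra.counit (R := ℂ) a * Coalgebra.counit (R := ℂ) b := by
  induction a using ind with
  | hz => simp
  | hadd _ _ h h' => simp [add_mul, h, h']
  | hsmul r _ h => simp [h, mul_assoc]
  | he g x =>
  induction b using ind with
  | hz => simp
  | hadd _ _ h h' => simp [mul_add, h, h']
  | hsmul r _ h => simp [h, mul_left_comm]
  | he h y =>
  rw [e_mul_e, counit_e, counit_e]
  by_cases h1 : g = x * h * x⁻¹
  · subst h1; simp [counit_e]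
  · simp only [h1, if_false, map_zero]
    by_cases h2 : h = 1
    · subst h2
      have : g ≠ 1 := by simpa using h1
      simp [this]
    · simp [h2]

open Classical in
theorem comul_mul' (a b : DrinfeldDouble G) : Coalgebra.comul (R := ℂ) (a * b) =
    Coalgebra.comul (R := ℂ) a * Coalgebra.comul (R := ℂ) b := by
  induction a using ind with
  | hz => simp
  | hadd _ _ h h' => simp [add_mul, h, h']
  | hsmul r _ h => simp only [smul_mul_assoc, map_smul, h]
  | he g x =>
  induction b using ind with
  | hz => simp
  | hadd _ _ h h' => simp [mul_add, h, h']
  | hsmul r _ h => simp only [mul_smul_comm, map_smul, h]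
  | he h y =>
  rw [e_mul_e, comul_e, comul_e, Finset.sum_mul_sum]
  simp only [Algebra.TensorProduct.tmul_mul_tmul, e_mul_e]
  have key : ∀ b c : G, ((if b = x * c * x⁻¹ then e b (x * y) else 0 : DrinfeldDouble G) ⊗ₜ[ℂ]
      (if g * b⁻¹ = x * (h * c⁻¹) * x⁻¹ then e (g * b⁻¹) (x * y) else 0 : DrinfeldDouble G))
      = if c = x⁻¹ * b * x then (if g = x * h * x⁻¹ then
        e b (x * y) ⊗ₜ[ℂ] e (g * b⁻¹) (x * y) else 0) else 0 := by
    intro b c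
    by_cases h1 : c = x⁻¹ * b * x
    · subst h1
      have h2 : (g * b⁻¹ = x * (h * (x⁻¹ * b * x)⁻¹) * x⁻¹) ↔ g = x * h * x⁻¹ := by
        simp [mul_assoc, ← mul_inv_eq_iff_eq_mul]
      simp only [h2]
      have h4 : b = x * (x⁻¹ * b * x) * x⁻¹ := by group
      rw [if_pos trivial, if_pos h4]
      by_cases h3 : g = x * h * x⁻¹ <;> simp [h3]
    · have : ¬ b = x * c * x⁻¹ := by
        rintro rfl; apply h1; group
      simp [h1, this]
  simp only [key, Finset.sum_ite_eq', Finset.mem_univ, if_true]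
  by_cases h1 : g = x * h * x⁻¹
  · simp [h1, comul_e]
  · simp [h1]

noncomputable instance : Bialgebra ℂ (DrinfeldDouble G) :=
  Bialgebra.mk' ℂ _
    (by classical simp [one_def, counit_e])
    (by intro a b; exact counit_mul' a b)
    (by
      simp only [one_def, map_sum, comul_e, Algebra.TensorProduct.one_def, TensorProduct.sum_tmul,
        TensorProduct.tmul_sum]
      rw [Finset.sum_comm]
      conv_rhs => rw [Finset.sum_comm]
      refine Finset.sum_congr rfl fun b _ => ?_
      exact Fintype.sum_equiv (Equiv.mulRight b⁻¹) _ _ fun g => by simp)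
    (by intro a b; exact comul_mul' a b)

open Classical in
/-- The antipode is `S(p_g ⋈ y) = p_{y⁻¹ g⁻¹ y} ⋈ y⁻¹`. -/
noncomputable instance : HopfAlgebra ℂ (DrinfeldDouble G) where
  antipode := lift fun g y => e (y⁻¹ * g⁻¹ * y) y⁻¹
  mul_antipode_rTensor_comul := by
    refine hom_ext fun g y => ?_
    have : ∀ b : G, (y⁻¹ * b⁻¹ * y = y⁻¹ * (g * b⁻¹) * y) ↔ g = 1 := by
      intro b; simp
    simp only [LinearMap.comp_apply, comul_e, map_sum, LinearMap.rTensor_tmul, lift_e,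
      LinearMap.mul'_apply, e_mul_e, counit_e, inv_inv, this]
    by_cases h : g = 1
    · subst h
      simp only [if_true, inv_mul_cancel, map_one, one_def, Algebra.linearMap_apply]
      exact Fintype.sum_equiv ((Equiv.inv G).trans (MulAut.conj y⁻¹).toEquiv) _ _
        fun b => by simp
    · simp [h]
  mul_antipode_lTensor_comul := by
    refine hom_ext fun g y => ?_
    have : ∀ b : G, (b = y * (y⁻¹ * (g * b⁻¹)⁻¹ * y) * y⁻¹) ↔ g = 1 := by
      intro b; simp [mul_assoc]
    have h2 : ∀ b : G, e b y * e (y⁻¹ * (g * b⁻¹)⁻¹ * y) y⁻¹ = if g = 1 then e b 1 else 0 := by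
      intro b
      rw [e_mul_e]
      by_cases h : g = 1
      · rw [if_pos ((this b).2 h), if_pos h, mul_inv_cancel]
      · rw [if_neg (fun h' => h ((this b).1 h')), if_neg h]
    simp only [LinearMap.comp_apply, comul_e, map_sum, LinearMap.lTensor_tmul, lift_e,
      LinearMap.mul'_apply, counit_e, h2]
    by_cases h : g = 1
    · subst h; simp [one_def]
    · simp [h]

theorem isNormalizedIntegral_explicit : IsNormalizedIntegral
    ((Fintype.card G : ℂ)⁻¹ • ∑ y : G, e (1 : G) y) := by
  have hc : (Fintype.card G : ℂ) ≠ 0 := by simp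
  refine ⟨fun a => ?_, fun a => ?_, ?_⟩
  · induction a using ind with
    | hz => simp
    | hadd _ _ h h' => simp only [add_mul, h, h', map_add, add_smul]
    | hsmul r _ h => simp only [smul_mul_assoc, h, map_smul, smul_eq_mul, mul_smul]
    | he g x =>
    rw [mul_smul_comm, smul_comm, Finset.mul_sum, counit_e]
    refine congrArg _ ?_
    by_cases h : g = 1
    · subst h
      simp only [e_mul_e, mul_one, mul_inv_cancel, if_true, one_smul]
      exact Fintype.sum_equiv (Equiv.mulLeft x) _ _ fun b => by simp
    · simp [e_mul_e, h]
  · induction a using ind with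
    | hz => simp
    | hadd _ _ h h' => simp only [mul_add, h, h', map_add, add_smul]
    | hsmul r _ h => simp only [mul_smul_comm, h, map_smul, smul_eq_mul, mul_smul]
    | he g x =>
    rw [smul_mul_assoc, smul_comm, Finset.sum_mul, counit_e]
    refine congrArg _ ?_
    by_cases h : g = 1
    · subst h
      simp only [e_mul_e, mul_one, mul_inv_cancel, if_true, one_smul]
      exact Fintype.sum_equiv (Equiv.mulRight x) _ _ fun b => by simp
    · have : ∀ y : G, ¬ (1 = y * g * y⁻¹) := by
        intro y h'; apply h
        have := congrArg (fun t => y⁻¹ * t * y) h'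
        simpa [mul_assoc] using this.symm
      simp [e_mul_e, h, this]
  · simp [counit_e]

variable (G) in
/-- The integral `Λ` of `D(G)` with `ε(Λ) = 1`, unique by `IsNormalizedIntegral.unique`. -/
noncomputable def integral : DrinfeldDouble G :=
  Classical.choose (⟨_, isNormalizedIntegral_explicit⟩ :
    ∃ Λ : DrinfeldDouble G, IsNormalizedIntegral Λ)

theorem integral_spec : IsNormalizedIntegral (integral G) :=
  Classical.choose_spec (⟨_, isNormalizedIntegral_explicit⟩ :
    ∃ Λ : DrinfeldDouble G, IsNormalizedIntegral Λ)

end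

end DrinfeldDouble

/-! ## The modules `M(class(s), ρ)` -/

/-- The conjugacy class of `s`, as a type. -/
abbrev ConjClass {G : Type*} [Group G] (s : G) : Type _ := {t : G // IsConj s t}

/-- A choice, for every `t` in the class of `s`, of an element `g_t` with `g_t s g_t⁻¹ = t`. -/
structure ConjTransversal {G : Type*} [Group G] (s : G) where
  rep : ConjClass s → G
  conj_rep : ∀ t, rep t * s * (rep t)⁻¹ = t

theorem ConjTransversal.nonempty {G : Type*} [Group G] (s : G) :
    Nonempty (ConjTransversal s) := by
  have : ∀ t : ConjClass s, ∃ g : G, g * s * g⁻¹ = t := fun t => isConj_iff.1 t.2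
  choose f hf using this
  exact ⟨⟨f, hf⟩⟩

section DoubleModule

variable {G : Type*} [Group G] {s : G} {W : Type*} [AddCommGroup W] [Module ℂ W]

/-- The underlying space of `M(class(s), ρ)`: the direct sum, over the elements `t` of the
(finite) class of `s`, of copies `g_t ⊗ W` of the space `W` of `ρ`. -/
def DoubleModule (_ρ : Representation ℂ (Subgroup.centralizer {s}) W) (_τ : ConjTransversal s) :
    Type _ := ConjClass s → W

namespace DoubleModule

variable (ρ : Representation ℂ (Subgroup.centralizer {s}) W) (τ : ConjTransversal s)

noncomputable instance : AddCommGroup (DoubleModule ρ τ) :=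
  inferInstanceAs (AddCommGroup (ConjClass s → W))

noncomputable instance : Module ℂ (DoubleModule ρ τ) :=
  inferInstanceAs (Module ℂ (ConjClass s → W))

/-- The element `y t y⁻¹` of the class of `s`. -/
def conjBy (y : G) (t : ConjClass s) : ConjClass s :=
  ⟨y * t * y⁻¹, t.2.trans (isConj_iff.2 ⟨y, rfl⟩)⟩

/-- For `t` in the class of `s`, the element `γ` of the centralizer of `s` with
`y g_{y⁻¹ t y} = g_t γ`. -/
def cocycle (y : G) (t : ConjClass s) : Subgroup.centralizer {s} :=
  ⟨(τ.rep t)⁻¹ * y * τ.rep (conjBy y⁻¹ t), by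
    have h1 := τ.conj_rep t
    have h2 := τ.conj_rep (conjBy y⁻¹ t)
    have h3 : ((conjBy y⁻¹ t : ConjClass s) : G) = y⁻¹ * t * y := by simp [conjBy]
    rw [h3, mul_inv_eq_iff_eq_mul] at h2
    rw [mul_inv_eq_iff_eq_mul] at h1
    have h4 : s * (τ.rep t)⁻¹ = (τ.rep t)⁻¹ * t := by
      rw [mul_inv_eq_iff_eq_mul, mul_assoc, ← h1, inv_mul_cancel_left]
    rw [Subgroup.mem_centralizer_singleton_iff, mul_assoc, h2, ← mul_assoc s, ← mul_assoc s, h4]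
    simp only [mul_assoc, mul_inv_cancel_left]⟩

/-- The action of `y : G`, which is `y · (g_{t'} ⊗ w) = g_t ⊗ ρ(γ) w` for `t = y t' y⁻¹` and
`y g_{t'} = g_t γ`. -/
def groupAct (y : G) : DoubleModule ρ τ →ₗ[ℂ] DoubleModule ρ τ where
  toFun f := fun t => ρ (cocycle τ y t) (f (conjBy y⁻¹ t))
  map_add' _ _ := funext fun t => map_add (ρ (cocycle τ y t)) _ _
  map_smul' c _ := funext fun t => map_smul (ρ (cocycle τ y t)) c _

open Classical in
/-- The action of `p_g`: the projection onto the component of degree `g`. -/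
noncomputable def gradeProj (g : G) : DoubleModule ρ τ →ₗ[ℂ] DoubleModule ρ τ where
  toFun f := fun t => if (t : G) = g then f t else 0
  map_add' f f' := funext fun t => by
    change (if (t : G) = g then f t + f' t else 0) = (if _ then _ else _) + (if _ then _ else _)
    split_ifs <;> simp
  map_smul' c f := funext fun t => by
    change (if (t : G) = g then c • f t else 0) = c • (if _ then _ else _)
    split_ifs <;> simp

/-- The representation of `D(G)`, in which `p_g ⋈ y` acts as `y` followed by `p_g`. -/
noncomputable def doubleActLin [Fintype G] :
    DrinfeldDouble G →ₗ[ℂ] Module.End ℂ (DoubleModule ρ τ) :=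
  DrinfeldDouble.lift fun g y => gradeProj ρ τ g ∘ₗ groupAct ρ τ y

theorem conjBy_mul (x y : G) (t : ConjClass s) : conjBy (x * y) t = conjBy x (conjBy y t) :=
  Subtype.ext (by simp [conjBy, mul_assoc])

theorem groupAct_one : groupAct ρ τ 1 = LinearMap.id := by
  refine LinearMap.ext fun f => funext fun t => ?_
  have h : conjBy (1 : G)⁻¹ t = t := Subtype.ext (by simp [conjBy])
  have h2 : cocycle τ 1 t = 1 := Subtype.ext (by simp only [cocycle, h]; simp)
  change ρ (cocycle τ 1 t) (f (conjBy (1 : G)⁻¹ t)) = f t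
  rw [h2, h]; simp

theorem groupAct_mul (x y : G) : groupAct ρ τ (x * y) = groupAct ρ τ x ∘ₗ groupAct ρ τ y := by
  refine LinearMap.ext fun f => funext fun t => ?_
  have h : conjBy (x * y)⁻¹ t = conjBy y⁻¹ (conjBy x⁻¹ t) := by rw [mul_inv_rev, conjBy_mul]
  have h2 : cocycle τ (x * y) t = cocycle τ x t * cocycle τ y (conjBy x⁻¹ t) :=
    Subtype.ext (by simp only [cocycle, h, Subgroup.coe_mul]; group)
  change ρ (cocycle τ (x * y) t) (f (conjBy (x * y)⁻¹ t)) =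
    ρ (cocycle τ x t) (ρ (cocycle τ y (conjBy x⁻¹ t)) (f (conjBy y⁻¹ (conjBy x⁻¹ t))))
  rw [h2, h, map_mul]; rfl

open Classical in
theorem gradeProj_groupAct (g x h : G) :
    gradeProj ρ τ g ∘ₗ groupAct ρ τ x ∘ₗ gradeProj ρ τ h =
      if g = x * h * x⁻¹ then gradeProj ρ τ g ∘ₗ groupAct ρ τ x else 0 := by
  refine LinearMap.ext fun f => funext fun t => ?_
  have e1 : (gradeProj ρ τ g ∘ₗ groupAct ρ τ x ∘ₗ gradeProj ρ τ h) f t =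
    if (t : G) = g then ρ (cocycle τ x t)
      (if ((conjBy x⁻¹ t : ConjClass s) : G) = h then f (conjBy x⁻¹ t) else 0) else 0 := rfl
  have e2 : (gradeProj ρ τ g ∘ₗ groupAct ρ τ x) f t =
    if (t : G) = g then ρ (cocycle τ x t) (f (conjBy x⁻¹ t)) else 0 := rfl
  have e3 : ((conjBy x⁻¹ t : ConjClass s) : G) = h ↔ (t : G) = x * h * x⁻¹ := by
    simp only [conjBy, inv_inv]
    constructor
    · rintro rfl; group
    · intro h'; rw [h']; group
  rw [e1]
  by_cases h1 : g = x * h * x⁻¹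
  · rw [if_pos h1, e2]
    by_cases h2 : (t : G) = g
    · rw [if_pos h2, if_pos h2, if_pos (e3.2 (h2.trans h1))]
    · rw [if_neg h2, if_neg h2]
  · rw [if_neg h1]
    by_cases h2 : (t : G) = g
    · rw [if_pos h2, if_neg (fun h3 => h1 (h2.symm.trans (e3.1 h3)))]
      exact map_zero _
    · rw [if_neg h2]; rfl

theorem doubleActLin_mul [Fintype G] (a b : DrinfeldDouble G) :
    doubleActLin ρ τ (a * b) = doubleActLin ρ τ a * doubleActLin ρ τ b := by
  induction a using DrinfeldDouble.ind with
  | hz => simp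
  | hadd _ _ h h' => simp [add_mul, h, h']
  | hsmul r _ h => simp [h]
  | he g x =>
  induction b using DrinfeldDouble.ind with
  | hz => simp
  | hadd _ _ h h' => simp [mul_add, h, h']
  | hsmul r _ h => simp [h]
  | he h y =>
  rw [DrinfeldDouble.e_mul_e]
  have e1 : doubleActLin ρ τ (DrinfeldDouble.e g x) * doubleActLin ρ τ (DrinfeldDouble.e h y) =
      (gradeProj ρ τ g ∘ₗ groupAct ρ τ x ∘ₗ gradeProj ρ τ h) ∘ₗ groupAct ρ τ y := by
    simp only [doubleActLin, DrinfeldDouble.lift_e]; rfl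
  rw [e1, gradeProj_groupAct]
  split_ifs
  · simp only [doubleActLin, DrinfeldDouble.lift_e, groupAct_mul]; rfl
  · simp

theorem doubleActLin_one [Fintype G] : doubleActLin ρ τ (1 : DrinfeldDouble G) = 1 := by
  classical
  refine LinearMap.ext fun f => funext fun t => ?_
  have e1 : doubleActLin ρ τ (1 : DrinfeldDouble G) = ∑ g : G, gradeProj ρ τ g := by
    simp only [DrinfeldDouble.one_def, map_sum, doubleActLin, DrinfeldDouble.lift_e, groupAct_one]
    rfl
  rw [e1, LinearMap.sum_apply]
  have e2 : (∑ g : G, gradeProj ρ τ g f) t = ∑ g : G, gradeProj ρ τ g f t :=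
    Finset.sum_apply (M := fun _ : ConjClass s => W) t Finset.univ
      (fun g => gradeProj ρ τ g f)
  rw [e2]
  have e3 : ∀ g : G, gradeProj ρ τ g f t = if (t : G) = g then f t else 0 := fun g => by
    simp only [gradeProj]; rfl
  simp only [e3]
  simp

/-- The algebra homomorphism `D(G) → End(M(class(s), ρ))`. -/
noncomputable def doubleAct [Fintype G] :
    DrinfeldDouble G →ₐ[ℂ] Module.End ℂ (DoubleModule ρ τ) :=
  AlgHom.ofLinearMap (doubleActLin ρ τ) (doubleActLin_one ρ τ) (doubleActLin_mul ρ τ)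

noncomputable instance [Fintype G] : Module (DrinfeldDouble G) (DoubleModule ρ τ) :=
  Module.compHom (DoubleModule ρ τ) (doubleAct ρ τ).toRingHom

theorem smul_def [Fintype G] (a : DrinfeldDouble G) (f : DoubleModule ρ τ) :
    a • f = doubleAct ρ τ a f := rfl

instance [Fintype G] : IsScalarTower ℂ (DrinfeldDouble G) (DoubleModule ρ τ) where
  smul_assoc c a f := by simp [smul_def]

end DoubleModule

end DoubleModule

/-! ## The groups `ℤ_{2^l} ⋊ D_k` -/

/-- The three generators `a, u, v`. -/
inductive GroupGen : Type
  | a | u | v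

open FreeGroup in
/-- The relators of the presentation
`⟨a, u, v | a^(2^l) = u^k = v^2 = 1, u a u⁻¹ = a^(n₁), v a v = a^(n₂), v u v = u⁻¹⟩` with
`n₁ = 2^(l-1) + 1` and `n₂ = 2^(l-1) - 1`. -/
def groupRels (k l : ℕ) : Set (FreeGroup GroupGen) :=
  {of .a ^ 2 ^ l, of .u ^ k, of .v ^ 2,
    of .u * of .a * (of .u)⁻¹ * (of .a ^ (2 ^ (l - 1) + 1))⁻¹,
    of .v * of .a * of .v * (of .a ^ (2 ^ (l - 1) - 1))⁻¹,
    of .v * of .u * of .v * of .u}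

/-- The group `ℤ_{2^l} ⋊ D_k`, given by its presentation. -/
abbrev ZDGroup (k l : ℕ) : Type := PresentedGroup (groupRels k l)

namespace ZDGroup

variable {k l : ℕ}

/-- The generator `a`. -/
def a : ZDGroup k l := PresentedGroup.of .a

/-- The generator `u`. -/
def u : ZDGroup k l := PresentedGroup.of .u

/-- The generator `v`. -/
def v : ZDGroup k l := PresentedGroup.of .v

theorem a_pow : (a : ZDGroup k l) ^ 2 ^ l = 1 :=
  PresentedGroup.one_of_mem (rels := groupRels k l) (x := FreeGroup.of .a ^ 2 ^ l)
    (by simp [groupRels])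

theorem u_pow : (u : ZDGroup k l) ^ k = 1 := by
  have h := PresentedGroup.one_of_mem (rels := groupRels k l) (x := FreeGroup.of .u ^ k)
    (by simp [groupRels])
  rw [map_pow] at h
  exact h

theorem v_sq : (v : ZDGroup k l) ^ 2 = 1 :=
  PresentedGroup.one_of_mem (rels := groupRels k l) (x := FreeGroup.of .v ^ 2)
    (by simp [groupRels])

theorem u_conj_a : (u : ZDGroup k l) * a * u⁻¹ = a ^ (2 ^ (l - 1) + 1) := by
  have h := PresentedGroup.one_of_mem (rels := groupRels k l)
    (x := FreeGroup.of .u * FreeGroup.of .a * (FreeGroup.of .u)⁻¹ *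
      (FreeGroup.of .a ^ (2 ^ (l - 1) + 1))⁻¹) (by simp [groupRels])
  exact mul_inv_eq_one.1 h

theorem v_conj_a : (v : ZDGroup k l) * a * v = a ^ (2 ^ (l - 1) - 1) := by
  have h := PresentedGroup.one_of_mem (rels := groupRels k l)
    (x := FreeGroup.of .v * FreeGroup.of .a * FreeGroup.of .v *
      (FreeGroup.of .a ^ (2 ^ (l - 1) - 1))⁻¹) (by simp [groupRels])
  exact mul_inv_eq_one.1 h

theorem v_conj_u : (v : ZDGroup k l) * u * v = u⁻¹ := by
  have h := PresentedGroup.one_of_mem (rels := groupRels k l)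
    (x := FreeGroup.of .v * FreeGroup.of .u * FreeGroup.of .v * FreeGroup.of .u)
    (by simp [groupRels])
  exact eq_inv_of_mul_eq_one_left h

theorem v_inv : (v : ZDGroup k l)⁻¹ = v :=
  inv_eq_of_mul_eq_one_left (by rw [← sq, v_sq])

/-- Every element has the form `a^x u^y v^z`. -/
theorem exists_normal_form [NeZero k] (g : ZDGroup k l) : ∃ x y z : ℤ, g = a ^ x * u ^ y * v ^ z := by
  have hu : ∀ x : ℤ, (u : ZDGroup k l) * a ^ x = a ^ ((2 ^ (l - 1) + 1 : ℕ) * x) * u := by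
    intro x
    rw [← mul_inv_eq_iff_eq_mul, ← conj_zpow, u_conj_a, zpow_mul, zpow_natCast]
  have hv : ∀ x : ℤ, (v : ZDGroup k l) * a ^ x = a ^ ((2 ^ (l - 1) - 1 : ℕ) * x) * v := by
    intro x
    have h := v_conj_a (k := k) (l := l)
    nth_rewrite 2 [← v_inv] at h
    rw [← mul_inv_eq_iff_eq_mul, ← conj_zpow, h, zpow_mul, zpow_natCast]
  have hvu : ∀ y : ℤ, (v : ZDGroup k l) * u ^ y = u ^ (-y) * v := by
    intro y
    have h := v_conj_u (k := k) (l := l)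
    nth_rewrite 2 [← v_inv] at h
    rw [← mul_inv_eq_iff_eq_mul, ← conj_zpow, h, inv_zpow, zpow_neg]
  have step : ∀ (j : GroupGen) (g : ZDGroup k l), (∃ x y z : ℤ, g = a ^ x * u ^ y * v ^ z) →
      ∃ x y z : ℤ, PresentedGroup.of j * g = a ^ x * u ^ y * v ^ z := by
    rintro j _ ⟨x, y, z, rfl⟩
    cases j with
    | a => exact ⟨1 + x, y, z, by
        change a * _ = _
        rw [zpow_add, zpow_one]; simp only [mul_assoc]⟩
    | u => exact ⟨(2 ^ (l - 1) + 1 : ℕ) * x, 1 + y, z, by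
        change u * _ = _
        rw [← mul_assoc, ← mul_assoc, hu, zpow_add, zpow_one]; simp only [mul_assoc]⟩
    | v => exact ⟨(2 ^ (l - 1) - 1 : ℕ) * x, -y, 1 + z, by
        change v * _ = _
        rw [← mul_assoc, ← mul_assoc, hv, mul_assoc (_ ^ _) v, hvu, zpow_add, zpow_one]
        simp only [mul_assoc]⟩
  have step' : ∀ (j : GroupGen) (n : ℕ) (g : ZDGroup k l),
      (∃ x y z : ℤ, g = a ^ x * u ^ y * v ^ z) →
      ∃ x y z : ℤ, (PresentedGroup.of j) ^ n * g = a ^ x * u ^ y * v ^ z := by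
    intro j n
    induction n with
    | zero => intro g hg; simpa using hg
    | succ n ih => intro g hg; rw [pow_succ', mul_assoc]; exact step j _ (ih g hg)
  have inv_eq : ∀ j : GroupGen, ∃ n : ℕ,
      (PresentedGroup.of j : ZDGroup k l)⁻¹ = (PresentedGroup.of j) ^ n := by
    have aux : ∀ (n : ℕ) (b : ZDGroup k l), 0 < n → b ^ n = 1 → b⁻¹ = b ^ (n - 1) := by
      intro n b hn hb
      refine inv_eq_of_mul_eq_one_left ?_
      rw [← pow_succ, Nat.sub_add_cancel hn, hb]
    intro j
    cases j with
    | a => exact ⟨_, aux _ _ (by positivity) a_pow⟩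
    | u => exact ⟨_, aux _ _ (NeZero.pos k) u_pow⟩
    | v => exact ⟨_, aux _ _ (by norm_num) v_sq⟩
  have hg : g ∈ Subgroup.closure (Set.range (PresentedGroup.of (rels := groupRels k l))) := by
    rw [PresentedGroup.closure_range_of]; trivial
  induction hg using Subgroup.closure_induction_left with
  | one => exact ⟨0, 0, 0, by simp⟩
  | mul_left x hx y hy ih =>
    obtain ⟨j, rfl⟩ := hx
    exact step j y ih
  | inv_mul_cancel x hx y hy ih =>
    obtain ⟨j, rfl⟩ := hx
    obtain ⟨n, hn⟩ := inv_eq j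
    rw [hn]
    exact step' j n y ih

instance [NeZero k] : Finite (ZDGroup k l) := by
  have key : ∀ (n : ℕ) (b : ZDGroup k l), 0 < n → b ^ n = 1 → ∀ x : ℤ,
      ∃ i : Fin n, b ^ x = b ^ (i : ℕ) := by
    intro n b hn hb x
    have hn' : (n : ℤ) ≠ 0 := by exact_mod_cast hn.ne'
    refine ⟨⟨(x % n).toNat, ?_⟩, ?_⟩
    · have := Int.emod_lt_of_pos x (by exact_mod_cast hn : (0 : ℤ) < n)
      have := Int.emod_nonneg x hn'
      omega
    · have h1 : b ^ x = b ^ (x % n) := by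
        conv_lhs => rw [← Int.emod_add_mul_ediv x n, zpow_add, zpow_mul, zpow_natCast, hb]
        simp
      rw [h1, ← zpow_natCast]
      congr 1
      exact (Int.toNat_of_nonneg (Int.emod_nonneg x hn')).symm
  refine Finite.of_surjective
    (fun p : Fin (2 ^ l) × Fin k × Fin 2 =>
      (a ^ (p.1 : ℕ) * u ^ (p.2.1 : ℕ) * v ^ (p.2.2 : ℕ) : ZDGroup k l)) ?_
  intro g
  obtain ⟨x, y, z, rfl⟩ := exists_normal_form g
  obtain ⟨i, hi⟩ := key _ a (by positivity) a_pow x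
  obtain ⟨j, hj⟩ := key _ u (NeZero.pos k) u_pow y
  obtain ⟨t, ht⟩ := key _ v (by norm_num) v_sq z
  exact ⟨(i, j, t), by simp only [hi, hj, ht]⟩

noncomputable instance [NeZero k] : Fintype (ZDGroup k l) := Fintype.ofFinite _

end ZDGroup

/-! The normalized integral is the average over `y` of `p_1 ⋈ y`, and its `m`-th Sweedler power is
the average over `y` of the sum of `p_h ⋈ y^m` over all `h` with `(y h)^m = y^m`
(`sweedlerPow_integral`). On `M(class(s), ρ)` only `h` in the class of `s` have nonzero trace. If
every solution of `(y s)^m = y^m` has `y^m = 1`, each such term has trace `dim W`, and the indicator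
is the number of solutions times `dim W / |C(s)|` (`indicator_doubleModule`).

For `s = a^r u^i v` with `i` odd, the twists by the involution `b = a^(2^(l-1))` coming from `v` and
from `u^i` cancel, so `s` inverts `a`; moreover `s² = 1`. A sign character forces `m` to be even.
For `y = a^x u^j` the equation then splits into `(a^x)^m = 1` and `(u^j)^m = 1`
(`mul_refl_pow_eq_iff`); for `j` odd this uses `4 ∣ k`. The coset of `s` contributes equally, since
`y ↦ y s` swaps the two sides. The count is therefore `2 gcd(m, k) gcd(m, 2^l)`
(`card_mul_refl_pow_eq`).

The same count yields the remaining data: `m = 0` gives `|G|`, and `m = 2` gives `C(s)`, which has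
order 8 and exponent 2. Hence `C(s)` is abelian, `dim W = 1`, and the factor is `2/8 = 1/4`. -/

/-! ### Sweedler powers of the integral of `D(G)`. -/

open Classical in
theorem sweedlerPow_e {G : Type*} [Group G] [Fintype G] (m : ℕ) (g y : G) :
    sweedlerPow (DrinfeldDouble G) m (DrinfeldDouble.e g y) =
      ∑ h : G, if (y ^ m)⁻¹ * (y * h) ^ m = g then DrinfeldDouble.e h (y ^ m) else 0 := by
  induction m generalizing g with
  | zero =>
    simp only [sweedlerPow, LinearMap.comp_apply, DrinfeldDouble.counit_e, pow_zero, inv_one,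
      mul_one, Algebra.linearMap_apply, eq_comm (a := (1 : G))]
    by_cases h : g = 1 <;> simp [h, DrinfeldDouble.one_def]
  | succ m ih =>
    simp only [sweedlerPow, LinearMap.comp_apply, DrinfeldDouble.comul_e, map_sum,
      LinearMap.lTensor_tmul, LinearMap.mul'_apply, ih]
    refine Finset.sum_congr rfl fun b _ => ?_
    -- The only label that `p_b ⋈ y` does not annihilate from the left.
    rw [Finset.mul_sum, Finset.sum_eq_single (y⁻¹ * b * y)]
    · have h2 : ((y ^ m)⁻¹ * (y * (y⁻¹ * b * y)) ^ m = g * b⁻¹) ↔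
          (y ^ (m + 1))⁻¹ * (y * b) ^ (m + 1) = g := by
        have h0 : y * (y⁻¹ * b * y) = b * y := by group
        have h3 : (b * y) ^ m = y⁻¹ * (y * b) ^ m * y := by
          have := conj_pow (a := y⁻¹) (b := y * b) (i := m)
          rw [inv_inv] at this
          rw [← this]
          group
        rw [h0, h3, eq_mul_inv_iff_mul_eq, pow_succ' y, pow_succ (y * b), mul_inv_rev]
        simp only [mul_assoc]
      have h3 : b = y * (y⁻¹ * b * y) * y⁻¹ := by group
      by_cases h : (y ^ (m + 1))⁻¹ * (y * b) ^ (m + 1) = g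
      · rw [if_pos (h2.2 h), if_pos h, DrinfeldDouble.e_mul_e, if_pos h3, pow_succ']
      · rw [if_neg (fun h' => h (h2.1 h')), if_neg h, mul_zero]
    · intro h _ hne
      split_ifs
      · rw [DrinfeldDouble.e_mul_e, if_neg]
        rintro rfl
        apply hne
        group
      · rw [mul_zero]
    · simp

theorem integral_eq {G : Type*} [Group G] [Fintype G] : DrinfeldDouble.integral G =
    (Fintype.card G : ℂ)⁻¹ • ∑ y : G, DrinfeldDouble.e (1 : G) y :=
  DrinfeldDouble.integral_spec.unique DrinfeldDouble.isNormalizedIntegral_explicit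

open Classical in
theorem sweedlerPow_integral {G : Type*} [Group G] [Fintype G] (m : ℕ) :
    sweedlerPow (DrinfeldDouble G) m (DrinfeldDouble.integral G) =
      (Fintype.card G : ℂ)⁻¹ • ∑ y : G, ∑ h : G,
        if (y * h) ^ m = y ^ m then DrinfeldDouble.e h (y ^ m) else 0 := by
  simp only [integral_eq, map_smul, map_sum, sweedlerPow_e, inv_mul_eq_one,
    eq_comm (a := _ ^ m) (b := (_ * _) ^ m)]

/-! ### Traces, simplicity and indicators of `M(class(s), ρ)`. -/

section

variable {G : Type*} [Group G] {s : G} {W : Type*} [AddCommGroup W] [Module ℂ W]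
  (ρ : Representation ℂ (Subgroup.centralizer {s}) W) (τ : ConjTransversal s)

namespace DoubleModule

open Classical in
/-- The inclusion of the component of degree `t`. -/
noncomputable def incl (t : ConjClass s) : W →ₗ[ℂ] DoubleModule ρ τ :=
  LinearMap.single ℂ (fun _ : ConjClass s => W) t

/-- The component of degree `t`. -/
def comp (t : ConjClass s) : DoubleModule ρ τ →ₗ[ℂ] W :=
  LinearMap.proj (φ := fun _ : ConjClass s => W) t

theorem comp_incl (t : ConjClass s) : comp ρ τ t ∘ₗ incl ρ τ t = LinearMap.id :=
  open Classical in
  LinearMap.ext fun w => Pi.single_eq_same (M := fun _ : ConjClass s => W) t w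

/-- Factoring the projection through `W` turns its trace, by cyclicity, into the trace of the
identity of `W`. -/
theorem gradeProj_coe (t : ConjClass s) :
    gradeProj ρ τ (t : G) = incl ρ τ t ∘ₗ comp ρ τ t := by
  classical
  refine LinearMap.ext fun f => funext fun t' => ?_
  have e1 : gradeProj ρ τ (t : G) f t' = if (t' : G) = t then f t' else 0 := by
    simp only [gradeProj]; rfl
  have e2 : (incl ρ τ t ∘ₗ comp ρ τ t) f t' = if t' = t then f t else 0 := by
    refine Eq.trans ?_ (Pi.single_apply (M := W) t (f t) t')
    simp only [incl]; rfl
  rw [e1, e2]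
  by_cases h : t' = t
  · subst h; simp
  · rw [if_neg h, if_neg (fun h' => h (Subtype.ext h'))]

theorem gradeProj_of_not_isConj {g : G} (h : ¬ IsConj s g) : gradeProj ρ τ g = 0 := by
  classical
  refine LinearMap.ext fun f => funext fun t => ?_
  have e1 : gradeProj ρ τ g f t = if (t : G) = g then f t else 0 := by
    simp only [gradeProj]; rfl
  rw [e1, if_neg]
  · rfl
  · rintro rfl
    exact h t.2

theorem e_smul [Fintype G] (g y : G) (f : DoubleModule ρ τ) :
    DrinfeldDouble.e g y • f = gradeProj ρ τ g (groupAct ρ τ y f) := by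
  rw [smul_def]
  change doubleActLin ρ τ _ f = _
  simp only [doubleActLin, DrinfeldDouble.lift_e]
  rfl

theorem moduleChar_e [Fintype G] (g y : G) :
    moduleChar (DrinfeldDouble G) (DoubleModule ρ τ) (DrinfeldDouble.e g y) =
      LinearMap.trace ℂ _ (gradeProj ρ τ g ∘ₗ groupAct ρ τ y) := by
  unfold moduleChar
  congr 1
  exact LinearMap.ext fun f => e_smul ρ τ g y f

theorem finrank_eq [Fintype G] [FiniteDimensional ℂ W] :
    Module.finrank ℂ (DoubleModule ρ τ) = Nat.card (ConjClass s) * Module.finrank ℂ W := by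
  classical
  have := Module.finrank_pi_fintype ℂ (M := fun _ : ConjClass s => W)
  rw [Finset.sum_const, Finset.card_univ, smul_eq_mul, ← Nat.card_eq_fintype_card] at this
  exact this

instance [Finite G] [FiniteDimensional ℂ W] : FiniteDimensional ℂ (DoubleModule ρ τ) :=
  inferInstanceAs (FiniteDimensional ℂ (ConjClass s → W))

open Classical in
theorem moduleChar_e_one [Fintype G] [FiniteDimensional ℂ W] (g : G) :
    moduleChar (DrinfeldDouble G) (DoubleModule ρ τ) (DrinfeldDouble.e g 1) =
      if IsConj s g then (Module.finrank ℂ W : ℂ) else 0 := by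
  rw [moduleChar_e, groupAct_one, LinearMap.comp_id]
  split_ifs with h
  · rw [gradeProj_coe ρ τ ⟨g, h⟩, LinearMap.trace_comp_comm', comp_incl, LinearMap.trace_id]
  · rw [gradeProj_of_not_isConj ρ τ h, map_zero]

theorem groupAct_incl (y : G) (t t' : ConjClass s) (h : conjBy y⁻¹ t' = t) (w : W) :
    groupAct ρ τ y (incl ρ τ t w) = incl ρ τ t' (ρ (cocycle τ y t') w) := by
  classical
  subst h
  refine funext fun x => ?_
  have e1 : groupAct ρ τ y (incl ρ τ (conjBy y⁻¹ t') w) x =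
      ρ (cocycle τ y x) (if conjBy y⁻¹ x = conjBy y⁻¹ t' then w else 0) := by
    refine congrArg (ρ (cocycle τ y x)) ?_
    refine Eq.trans ?_ (Pi.single_apply (M := W) (conjBy y⁻¹ t') w _)
    simp only [incl]; rfl
  have e2 : incl ρ τ t' (ρ (cocycle τ y t') w) x =
      if x = t' then ρ (cocycle τ y t') w else 0 := by
    refine Eq.trans ?_ (Pi.single_apply (M := W) t' _ _)
    simp only [incl]; rfl
  rw [e1, e2]
  by_cases hx : x = t'
  · subst hx; simp
  · rw [if_neg hx, if_neg, map_zero]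
    intro h'
    apply hx
    have := congrArg (conjBy y) h'
    rw [← conjBy_mul, ← conjBy_mul, mul_inv_cancel] at this
    simpa [conjBy] using this

theorem sum_incl_comp [Fintype G] [Fintype (ConjClass s)] (f : DoubleModule ρ τ) :
    ∑ t, incl ρ τ t (comp ρ τ t f) = f := by
  classical
  refine Eq.trans ?_ (Finset.univ_sum_single (M := fun _ : ConjClass s => W) f)
  refine Finset.sum_congr rfl fun t _ => ?_
  simp only [incl]
  congr!

/-- The module `M(class(s), ρ)` is simple when `ρ` is one-dimensional. -/
theorem isSimpleModule_of_finrank_eq_one [Fintype G] (hW : Module.finrank ℂ W = 1) :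
    IsSimpleModule (DrinfeldDouble G) (DoubleModule ρ τ) := by
  classical
  have hfd : FiniteDimensional ℂ W := FiniteDimensional.of_finrank_eq_succ hW
  have hs : IsConj s s := IsConj.refl s
  have hnt : Nontrivial W := Module.nontrivial_of_finrank_pos (R := ℂ) (by omega)
  obtain ⟨w₀, hw₀⟩ := exists_ne (0 : W)
  have hcomp : ∀ t w, comp ρ τ t (incl ρ τ t w) = w := fun t w =>
    LinearMap.congr_fun (comp_incl ρ τ t) w
  have hproj : ∀ (t : ConjClass s) (f : DoubleModule ρ τ),
      DrinfeldDouble.e (t : G) 1 • f = incl ρ τ t (comp ρ τ t f) := fun t f => by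
    rw [e_smul, groupAct_one, gradeProj_coe]; rfl
  -- Since `W` is a line, one nonzero vector of a component spans it; a scalar `c` acts through `c •
  -- 1` in `D(G)`.
  have hinc : ∀ (N : Submodule (DrinfeldDouble G) (DoubleModule ρ τ)) (t : ConjClass s) (w : W),
      w ≠ 0 → incl ρ τ t w ∈ N → ∀ w', incl ρ τ t w' ∈ N := by
    intro N t w hw hN w'
    obtain ⟨c, rfl⟩ := exists_smul_eq_of_finrank_eq_one hW hw w'
    rw [map_smul, ← smul_one_smul (DrinfeldDouble G) c (incl ρ τ t w)]
    exact N.smul_mem _ hN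
  -- `G` permutes the components transitively and invertibly, so a single component generates
  -- everything.
  have htop : ∀ (N : Submodule (DrinfeldDouble G) (DoubleModule ρ τ)) (t : ConjClass s) (w : W),
      w ≠ 0 → incl ρ τ t w ∈ N → N = ⊤ := by
    intro N t w hw hN
    rw [eq_top_iff]
    rintro f -
    rw [← sum_incl_comp ρ τ f]
    refine N.sum_mem fun t' _ => ?_
    obtain ⟨y, hy⟩ := isConj_iff.1 (t.2.symm.trans t'.2)
    have hty : conjBy y⁻¹ t' = t := Subtype.ext (by
      simp only [conjBy, ← hy]; group)
    have h1 : DrinfeldDouble.e (t' : G) y • incl ρ τ t w =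
        incl ρ τ t' (ρ (cocycle τ y t') w) := by
      rw [e_smul, groupAct_incl ρ τ y t t' hty, gradeProj_coe, LinearMap.comp_apply, hcomp]
    refine hinc N t' (ρ (cocycle τ y t') w) ?_ (h1 ▸ N.smul_mem _ hN) _
    intro h0
    apply hw
    have := congrArg (ρ (cocycle τ y t')⁻¹) h0
    simpa using this
  have : Nontrivial (Submodule (DrinfeldDouble G) (DoubleModule ρ τ)) := by
    rw [Submodule.nontrivial_iff]
    refine ⟨incl ρ τ ⟨s, hs⟩ w₀, 0, fun h => hw₀ ?_⟩
    have := congrArg (comp ρ τ ⟨s, hs⟩) h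
    rwa [hcomp, map_zero] at this
  refine (isSimpleModule_iff _ _).2 ⟨fun N => ?_⟩
  rw [or_iff_not_imp_left]
  intro hN
  obtain ⟨f, hf, hf0⟩ := N.exists_mem_ne_zero_of_ne_bot hN
  obtain ⟨t, ht⟩ : ∃ t, comp ρ τ t f ≠ 0 := by
    by_contra! h
    exact hf0 (funext h)
  exact htop N t _ ht (hproj t f ▸ N.smul_mem _ hf)

end DoubleModule

/-- Orbit-stabilizer for the conjugation action. -/
theorem card_conjClass_mul_card_centralizer [Finite G] (s : G) :
    Nat.card (ConjClass s) * Nat.card (Subgroup.centralizer {s}) = Nat.card G := by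
  classical
  cases nonempty_fintype G
  have h := MulAction.card_orbit_mul_card_stabilizer_eq_card_group (ConjAct G) s
  rw [← Nat.card_eq_fintype_card, ← Nat.card_eq_fintype_card,
    ← Subgroup.nat_card_centralizer_nat_card_stabilizer] at h
  rw [← Nat.card_congr (Equiv.subtypeEquivRight fun t =>
    (ConjAct.mem_orbit_conjAct (g := t) (h := s)).trans isConj_comm), Nat.card_eq_fintype_card (α := G)]
  exact h

/-- Conjugation carries one solution set to the other, so all members of the class contribute
equally to the indicator. -/
theorem card_pow_mul_eq_of_isConj {s t : G} (h : IsConj s t) (m : ℕ) :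
    Nat.card {y : G // (y * t) ^ m = y ^ m} = Nat.card {y : G // (y * s) ^ m = y ^ m} := by
  obtain ⟨c, rfl⟩ := isConj_iff.1 h
  refine Nat.card_congr ((MulAut.conj c⁻¹).toEquiv.subtypeEquiv fun y => ?_)
  have h1 : c⁻¹ * y * c⁻¹⁻¹ * s = c⁻¹ * (y * (c * s * c⁻¹)) * c⁻¹⁻¹ := by group
  simp only [MulEquiv.toEquiv_eq_coe, MulEquiv.coe_toEquiv, MulAut.conj_apply]
  rw [h1, conj_pow, conj_pow, mul_left_inj, mul_right_inj]

theorem pow_eq_one_of_isConj {s t : G} (h : IsConj s t) {m : ℕ}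
    (hs : ∀ y : G, (y * s) ^ m = y ^ m → y ^ m = 1) (y : G) (hy : (y * t) ^ m = y ^ m) :
    y ^ m = 1 := by
  obtain ⟨c, rfl⟩ := isConj_iff.1 h
  have h1 : c⁻¹ * y * c⁻¹⁻¹ * s = c⁻¹ * (y * (c * s * c⁻¹)) * c⁻¹⁻¹ := by group
  have h2 := hs (c⁻¹ * y * c⁻¹⁻¹) (by rw [h1, conj_pow, conj_pow, hy])
  rwa [conj_pow, conj_eq_one_iff] at h2

/-- The indicators of `M(class(s), ρ)` when only elements with `y ^ m = 1` contribute. -/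
theorem indicator_doubleModule [Fintype G] [FiniteDimensional ℂ W] (m : ℕ)
    (hs : ∀ y : G, (y * s) ^ m = y ^ m → y ^ m = 1) :
    indicator (DrinfeldDouble.integral G) (DoubleModule ρ τ) m =
      (Nat.card {y : G // (y * s) ^ m = y ^ m} : ℂ) * Module.finrank ℂ W /
        Nat.card (Subgroup.centralizer {s}) := by
  classical
  have hlin : ∀ x, moduleChar (DrinfeldDouble G) (DoubleModule ρ τ) x =
      (LinearMap.trace ℂ (DoubleModule ρ τ) ∘ₗ
        (Algebra.lsmul ℂ ℂ (DoubleModule ρ τ)).toLinearMap) x := fun _ => rfl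
  -- Outside the class the projection vanishes; inside it `hs` reduces `p_h ⋈ y^m` to `p_h ⋈ 1`, so
  -- no value of the character of `ρ` other than its degree enters.
  have hterm : ∀ y h : G, moduleChar (DrinfeldDouble G) (DoubleModule ρ τ)
      (if (y * h) ^ m = y ^ m then DrinfeldDouble.e h (y ^ m) else 0) =
      if IsConj s h then (if (y * h) ^ m = y ^ m then (Module.finrank ℂ W : ℂ) else 0) else 0 := by
    intro y h
    by_cases h1 : (y * h) ^ m = y ^ m
    · rw [if_pos h1, if_pos h1]
      by_cases h2 : IsConj s h
      · rw [pow_eq_one_of_isConj h2 hs y h1, DoubleModule.moduleChar_e_one]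
      · rw [DoubleModule.moduleChar_e, DoubleModule.gradeProj_of_not_isConj ρ τ h2,
          LinearMap.zero_comp, map_zero, if_neg h2]
    · rw [if_neg h1, if_neg h1, hlin, map_zero, ite_self]
  have hcount : ∀ h : G, IsConj s h →
      (∑ y : G, if (y * h) ^ m = y ^ m then (Module.finrank ℂ W : ℂ) else 0) =
      (Nat.card {y : G // (y * s) ^ m = y ^ m} : ℂ) * Module.finrank ℂ W := by
    intro h hh
    rw [← card_pow_mul_eq_of_isConj hh, ← Finset.sum_filter, Finset.sum_const, nsmul_eq_mul,
      Nat.card_eq_fintype_card, Fintype.card_subtype]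
  have hC : (Nat.card (Subgroup.centralizer {s}) : ℂ) ≠ 0 := by
    exact_mod_cast Nat.card_pos.ne'
  have hcl : (Nat.card (ConjClass s) : ℂ) ≠ 0 := by
    have : Nonempty (ConjClass s) := ⟨⟨s, IsConj.refl s⟩⟩
    exact_mod_cast Nat.card_pos.ne'
  unfold indicator
  rw [sweedlerPow_integral, hlin, map_smul, map_sum, Finset.sum_congr rfl
    fun y _ => map_sum _ _ _]
  simp only [← hlin, hterm]
  rw [Finset.sum_comm]
  have : ∀ h : G, (∑ y : G, if IsConj s h then
      (if (y * h) ^ m = y ^ m then (Module.finrank ℂ W : ℂ) else 0) else 0) =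
      if IsConj s h then
        (Nat.card {y : G // (y * s) ^ m = y ^ m} : ℂ) * Module.finrank ℂ W else 0 := by
    intro h
    split_ifs with hh
    · exact hcount h hh
    · simp
  rw [Finset.sum_congr rfl fun h _ => this h, ← Finset.sum_filter, Finset.sum_const, nsmul_eq_mul,
    ← Fintype.card_subtype, ← Nat.card_eq_fintype_card, ← Nat.card_eq_fintype_card,
    ← card_conjClass_mul_card_centralizer s, Nat.cast_mul, smul_eq_mul]
  field_simp

end

open scoped IsMulCommutative in
theorem card_zpowers_pow_eq_one {G : Type*} [Group G] [Finite G] (g : G) (m : ℕ) :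
    Nat.card {p : Subgroup.zpowers g // p ^ m = 1} = (orderOf g).gcd m := by
  rw [← Nat.card_zpowers, ← IsCyclic.card_powMonoidHom_ker (G := Subgroup.zpowers g) m]
  rfl

/-! ### Quotients and actions of the presented group; orders of `a` and `u`. -/

namespace ZDGroup

variable {k l : ℕ}

/-- The homomorphism to the dihedral group with kernel generated by `a`. -/
def toDihedral (k l : ℕ) : ZDGroup k l →* DihedralGroup k :=
  PresentedGroup.toGroup (f := fun j => match j with
    | .a => 1 | .u => DihedralGroup.r 1 | .v => DihedralGroup.sr 0) (by
    intro x hx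
    simp only [groupRels, Set.mem_insert_iff, Set.mem_singleton_iff] at hx
    rcases hx with rfl | rfl | rfl | rfl | rfl | rfl <;>
    simp [sq])

/-- The sign homomorphism, `-1` on `v` and trivial on `a` and `u`. -/
def sign (k l : ℕ) : ZDGroup k l →* ℤˣ :=
  PresentedGroup.toGroup (f := fun j => match j with
    | .a => 1 | .u => 1 | .v => -1) (by
    intro x hx
    simp only [groupRels, Set.mem_insert_iff, Set.mem_singleton_iff] at hx
    rcases hx with rfl | rfl | rfl | rfl | rfl | rfl <;> simp)

@[simp] theorem toDihedral_a : toDihedral k l a = 1 := PresentedGroup.toGroup.of _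
@[simp] theorem toDihedral_u : toDihedral k l u = DihedralGroup.r 1 := PresentedGroup.toGroup.of _
@[simp] theorem toDihedral_v : toDihedral k l v = DihedralGroup.sr 0 := PresentedGroup.toGroup.of _
@[simp] theorem sign_a : sign k l a = 1 := PresentedGroup.toGroup.of _
@[simp] theorem sign_u : sign k l u = 1 := PresentedGroup.toGroup.of _
@[simp] theorem sign_v : sign k l v = -1 := PresentedGroup.toGroup.of _

theorem two_pow_mul_two_pow (hl : 2 ≤ l) :
    (2 : ZMod (2 ^ l)) ^ (l - 1) * 2 ^ (l - 1) = 0 := by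
  rw [← pow_add]
  have h : (((2 ^ (l - 1 + (l - 1)) : ℕ)) : ZMod (2 ^ l)) = 0 :=
    (ZMod.natCast_eq_zero_iff _ _).2 (pow_dvd_pow 2 (by omega))
  simpa using h

theorem two_pow_mul_two (hl : 2 ≤ l) : (2 : ZMod (2 ^ l)) ^ (l - 1) * 2 = 0 := by
  rw [← pow_succ]
  have h : (((2 ^ (l - 1 + 1) : ℕ)) : ZMod (2 ^ l)) = 0 :=
    (ZMod.natCast_eq_zero_iff _ _).2 (pow_dvd_pow 2 (by omega))
  simpa using h

/-- Both `2^(2(l-1))` and `2 · 2^(l-1)` vanish modulo `2^l`, so `2^(l-1) ± 1` square to 1. -/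
theorem u_mul_self (hl : 2 ≤ l) (z : ZMod (2 ^ l)) :
    (2 ^ (l - 1) + 1) * ((2 ^ (l - 1) + 1) * z) = z := by
  linear_combination z * two_pow_mul_two_pow hl + z * two_pow_mul_two hl

theorem v_mul_self (hl : 2 ≤ l) (z : ZMod (2 ^ l)) :
    (2 ^ (l - 1) - 1) * ((2 ^ (l - 1) - 1) * z) = z := by
  linear_combination z * two_pow_mul_two_pow hl - z * two_pow_mul_two hl

theorem addRight_one_pow {n : ℕ} (m : ℕ) (z : ZMod n) :
    ((Equiv.addRight (1 : ZMod n)) ^ m : Equiv.Perm (ZMod n)) z = z + m := by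
  induction m generalizing z with
  | zero => simp
  | succ m ih =>
    rw [pow_succ, Equiv.Perm.mul_apply, ih, Equiv.coe_addRight]
    push_cast
    ring

/-- The action on `ℤ/2^l` by affine maps. -/
noncomputable def toPerm (hl : 2 ≤ l) (hk : 2 ∣ k) : ZDGroup k l →* Equiv.Perm (ZMod (2 ^ l)) :=
  PresentedGroup.toGroup (f := fun j => match j with
    | .a => Equiv.addRight 1
    | .u => Function.Involutive.toPerm (fun z => (2 ^ (l - 1) + 1) * z) (u_mul_self hl)
    | .v => Function.Involutive.toPerm (fun z => (2 ^ (l - 1) - 1) * z) (v_mul_self hl)) (by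
    have hpow : ∀ n : ℕ, (Equiv.addRight (1 : ZMod (2 ^ l))) ^ n = Equiv.addRight (n : ZMod _) :=
      fun n => Equiv.ext (addRight_one_pow n)
    have hu2 : (Function.Involutive.toPerm (fun z : ZMod (2 ^ l) => (2 ^ (l - 1) + 1) * z)
        (u_mul_self hl)) ^ 2 = 1 := by
      ext z
      rw [sq]
      exact (u_mul_self hl z)
    intro x hx
    simp only [groupRels, Set.mem_insert_iff, Set.mem_singleton_iff] at hx
    rcases hx with rfl | rfl | rfl | rfl | rfl | rfl
    · simp only [map_pow, FreeGroup.lift_apply_of, hpow]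
      ext z
      change z + ((2 ^ l : ℕ) : ZMod (2 ^ l)) = z
      rw [ZMod.natCast_self, add_zero]
    -- Here `u` acts as an involution, so `u^k` acts trivially as soon as `k` is even.
    · obtain ⟨n, rfl⟩ := hk
      simp only [map_pow, FreeGroup.lift_apply_of, pow_mul, hu2, one_pow]
    · simp only [map_pow, FreeGroup.lift_apply_of]
      ext z
      rw [sq]
      exact (v_mul_self hl z)
    · simp only [map_mul, map_inv, map_pow, FreeGroup.lift_apply_of, hpow]
      rw [mul_inv_eq_one]
      ext z
      change (2 ^ (l - 1) + 1) * ((2 ^ (l - 1) + 1) * z + 1) = z + ((2 ^ (l - 1) + 1 : ℕ) : ZMod (2 ^ l))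
      push_cast
      linear_combination u_mul_self hl z
    · simp only [map_mul, map_inv, map_pow, FreeGroup.lift_apply_of, hpow]
      rw [mul_inv_eq_one]
      ext z
      change (2 ^ (l - 1) - 1) * ((2 ^ (l - 1) - 1) * z + 1) = z + ((2 ^ (l - 1) - 1 : ℕ) : ZMod (2 ^ l))
      rw [Nat.cast_sub Nat.one_le_two_pow]
      push_cast
      linear_combination v_mul_self hl z
    · simp only [map_mul, FreeGroup.lift_apply_of]
      ext z
      change (2 ^ (l - 1) - 1) * ((2 ^ (l - 1) + 1) * ((2 ^ (l - 1) - 1) *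
        ((2 ^ (l - 1) + 1) * z))) = z
      linear_combination (2 ^ (l - 1) - 1) ^ 2 * u_mul_self hl z + v_mul_self hl z)

theorem orderOf_u : orderOf (u : ZDGroup k l) = k := by
  refine Nat.dvd_antisymm (orderOf_dvd_of_pow_eq_one u_pow) ?_
  have := orderOf_map_dvd (toDihedral k l) u
  rwa [toDihedral_u, DihedralGroup.orderOf_r_one] at this

/-- The dihedral quotient kills `a`; the lower bound comes from the affine action, where `a` is
translation by 1. -/
theorem orderOf_a (hl : 2 ≤ l) (hk : 2 ∣ k) : orderOf (a : ZDGroup k l) = 2 ^ l := by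
  refine Nat.dvd_antisymm (orderOf_dvd_of_pow_eq_one a_pow) ?_
  have h : toPerm hl hk a = Equiv.addRight 1 := PresentedGroup.toGroup.of _
  have h2 := congrArg (toPerm hl hk) (pow_orderOf_eq_one (a : ZDGroup k l))
  rw [map_pow, h, map_one] at h2
  have h3 := DFunLike.congr_fun h2 0
  rw [addRight_one_pow] at h3
  simpa [ZMod.natCast_eq_zero_iff] using h3

theorem zpow_u_eq_one_iff (j : ℤ) : (u : ZDGroup k l) ^ j = 1 ↔ (k : ℤ) ∣ j := by
  rw [← orderOf_dvd_iff_zpow_eq_one, orderOf_u]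

theorem toDihedral_zpow_u_eq_one_iff (j : ℤ) :
    toDihedral k l u ^ j = 1 ↔ (u : ZDGroup k l) ^ j = 1 := by
  rw [zpow_u_eq_one_iff, ← orderOf_dvd_iff_zpow_eq_one, toDihedral_u, DihedralGroup.orderOf_r_one]

/-! ### Conjugation by `u` and `v`, expressed through `b`. -/

/-- The central involution `a ^ (2 ^ (l - 1))`. -/
def b : ZDGroup k l := a ^ 2 ^ (l - 1)

theorem b_sq (hl : 2 ≤ l) : (b : ZDGroup k l) ^ 2 = 1 := by
  rw [b, ← pow_mul, ← pow_succ, Nat.sub_add_cancel (by omega), a_pow]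

theorem b_comm_a : Commute (b : ZDGroup k l) a := (Commute.refl a).pow_left _

theorem u_mul_a : (u : ZDGroup k l) * a * u⁻¹ = b * a := by
  rw [u_conj_a, pow_succ, b]

theorem v_mul_a : (v : ZDGroup k l) * a * v⁻¹ = b * a⁻¹ := by
  rw [v_inv, v_conj_a, b, eq_mul_inv_iff_mul_eq, ← pow_succ, Nat.sub_add_cancel Nat.one_le_two_pow]

theorem b_inv (hl : 2 ≤ l) : (b : ZDGroup k l)⁻¹ = b :=
  inv_eq_of_mul_eq_one_left (by rw [← sq, b_sq hl])

theorem b_pow_even (hl : 2 ≤ l) {n : ℕ} (hn : Even n) : (b : ZDGroup k l) ^ n = 1 := by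
  obtain ⟨c, rfl⟩ := even_iff_two_dvd.1 hn
  rw [pow_mul, b_sq hl, one_pow]

theorem u_comm_b (hl : 3 ≤ l) : Commute (u : ZDGroup k l) b := by
  have h : (u : ZDGroup k l) * b * u⁻¹ = b := by
    conv_lhs => rw [b]
    rw [← conj_pow, u_mul_a, (b_comm_a).mul_pow, b_pow_even (by omega), one_mul, ← b]
    exact (Nat.even_pow.2 ⟨even_two, by omega⟩)
  exact mul_inv_eq_iff_eq_mul.1 h

theorem conj_u_zpow_a (x : ℤ) :
    (u : ZDGroup k l) * a ^ x * u⁻¹ = b ^ x * a ^ x := by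
  rw [← conj_zpow, u_mul_a, b_comm_a.mul_zpow]

/-- Each conjugation by `u` multiplies `a` by `b`, and `b² = 1`. Thus only the parity of an exponent
of `u` matters for its action on `a`. -/
theorem u_sq_comm_a (hl : 3 ≤ l) : Commute ((u : ZDGroup k l) ^ 2) a := by
  have h1 : (u : ZDGroup k l) ^ 2 * a * (u ^ 2)⁻¹ = u * (u * a * u⁻¹) * u⁻¹ := by
    rw [sq]; group
  have h2 : (u : ZDGroup k l) * (b * a) * u⁻¹ = b * (u * a * u⁻¹) := by
    rw [← mul_assoc, (u_comm_b hl).eq]; group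
  refine mul_inv_eq_iff_eq_mul.1 ?_
  rw [h1, u_mul_a, h2, u_mul_a, ← mul_assoc, ← sq, b_sq (by omega), one_mul]

theorem u_even_comm_a (hl : 3 ≤ l) {j : ℤ} (hj : Even j) : Commute ((u : ZDGroup k l) ^ j) a := by
  obtain ⟨c, rfl⟩ := even_iff_two_dvd.1 hj
  rw [zpow_mul, zpow_ofNat]
  exact (u_sq_comm_a hl).zpow_left c

theorem conj_u_odd (hl : 3 ≤ l) {j : ℤ} (hj : Odd j) (x : ℤ) :
    (u : ZDGroup k l) ^ j * a ^ x * (u ^ j)⁻¹ = b ^ x * a ^ x := by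
  obtain ⟨c, rfl⟩ := hj
  have h := ((u_even_comm_a (k := k) hl (even_two_mul c)).zpow_right x).eq
  have h1 : (u : ZDGroup k l) ^ (2 * c + 1) * a ^ x * (u ^ (2 * c + 1))⁻¹ =
      u * (u ^ (2 * c) * a ^ x * (u ^ (2 * c))⁻¹) * u⁻¹ := by
    rw [add_comm, zpow_add, zpow_one]; group
  rw [h1, h, mul_inv_cancel_right, conj_u_zpow_a]

theorem v_conj_zpow_u (j : ℤ) : (v : ZDGroup k l) * u ^ j * v⁻¹ = u ^ (-j) := by
  have h := v_conj_u (k := k) (l := l)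
  nth_rewrite 2 [← v_inv] at h
  rw [← conj_zpow, h, inv_zpow, zpow_neg]

/-! ### The involution `s = a^r u^i v` and the powers of `y` and `y s`. -/

section Reflection

variable (r i : ℤ)

/-- The element `a ^ r u ^ i v`. -/
def refl (k l : ℕ) (r i : ℤ) : ZDGroup k l := a ^ r * u ^ i * v

variable {i}

/-- `v` sends `a` to `b a⁻¹`, and the odd power `u^i` contributes a second factor `b`, which cancels
the first. This is where the parity of `i` enters. -/
theorem refl_conj_a (hl : 3 ≤ l) (hi : Odd i) (x : ℤ) :
    refl k l r i * a ^ x * (refl k l r i)⁻¹ = a ^ (-x) := by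
  have h1 : refl k l r i * a * (refl k l r i)⁻¹ =
      a ^ r * (u ^ i * (v * a * v⁻¹) * (u ^ i)⁻¹) * (a ^ r)⁻¹ := by
    simp only [refl]; group
  have h2 : (u : ZDGroup k l) ^ i * (b * a⁻¹) * (u ^ i)⁻¹ =
      b * (u ^ i * a ^ (-1 : ℤ) * (u ^ i)⁻¹) := by
    rw [← mul_assoc, ((u_comm_b hl).zpow_left i).eq]; group
  rw [← conj_zpow, h1, v_mul_a, h2, conj_u_odd hl hi, zpow_neg_one, b_inv (by omega), ← mul_assoc b,
    ← sq, b_sq (by omega), one_mul, zpow_neg_one, zpow_neg]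
  have : (a : ZDGroup k l) ^ r * a⁻¹ * (a ^ r)⁻¹ = a⁻¹ := by group
  rw [this, inv_zpow]

theorem refl_conj_u (j : ℤ) :
    refl k l r i * u ^ j * (refl k l r i)⁻¹ = a ^ r * u ^ (-j) * (a ^ r)⁻¹ := by
  have h1 : refl k l r i * u ^ j * (refl k l r i)⁻¹ =
      a ^ r * (u ^ i * (v * u ^ j * v⁻¹) * (u ^ i)⁻¹) * (a ^ r)⁻¹ := by
    simp only [refl]; group
  rw [h1, v_conj_zpow_u]
  group

/-- Moving `s` past `a^r` inverts it and cancels the leading `a^r` of `s`; what is left is `(u^i v)²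
= 1`. -/
theorem refl_mul_self (hl : 3 ≤ l) (hi : Odd i) : refl k l r i * refl k l r i = 1 := by
  have h1 : refl k l r i * refl k l r i =
      (refl k l r i * a ^ r * (refl k l r i)⁻¹) * refl k l r i * (u ^ i * v) := by
    rw [inv_mul_cancel_right, mul_assoc _ (a ^ r), ← mul_assoc (a ^ r), ← refl]
  have h2 : (u : ZDGroup k l) ^ i * v * (u ^ i * v) = u ^ i * (v * u ^ i * v⁻¹) * (v * v) := by
    group
  rw [h1, refl_conj_a r hl hi, refl, mul_assoc (a ^ r), ← mul_assoc (a ^ (-r)), ← zpow_add,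
    neg_add_cancel, zpow_zero, one_mul, h2, v_conj_zpow_u, ← zpow_add, add_neg_cancel, zpow_zero,
    ← sq, v_sq, one_mul]

/-- For even `j` the powers of `a` commute with `u^j`, so `s` inverts `y = a^x u^j` and already `(y
s)² = 1`. -/
theorem mul_refl_pow_of_even (hl : 3 ≤ l) (hi : Odd i) (x : ℤ) {j : ℤ} (hj : Even j) (n : ℕ) :
    (a ^ x * u ^ j * refl k l r i) ^ (2 * n) = 1 ∧
      (a ^ x * u ^ j : ZDGroup k l) ^ (2 * n) = (a ^ x) ^ (2 * n) * (u ^ j) ^ (2 * n) := by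
  have hc : Commute (a ^ x : ZDGroup k l) (u ^ j) :=
    ((u_even_comm_a hl hj).zpow_right x).symm
  have hc' : Commute (a ^ r : ZDGroup k l) (u ^ (-j)) :=
    ((u_even_comm_a hl hj.neg).zpow_right r).symm
  refine ⟨?_, hc.mul_pow _⟩
  have h1 : refl k l r i * (a ^ x * u ^ j) * (refl k l r i)⁻¹ = (a ^ x * u ^ j)⁻¹ := by
    rw [← conj_mul, refl_conj_a r hl hi, refl_conj_u, hc'.eq, mul_inv_cancel_right, hc.eq,
      mul_inv_rev, zpow_neg, zpow_neg]
  rw [pow_mul]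
  have h2 : (a ^ x * u ^ j * refl k l r i) ^ 2 = a ^ x * u ^ j *
      (refl k l r i * (a ^ x * u ^ j) * (refl k l r i)⁻¹) * (refl k l r i * refl k l r i) := by
    rw [sq]; group
  rw [h2, h1, mul_inv_cancel, refl_mul_self r hl hi, one_mul, one_pow]

/-- For odd `j` powers of `b` survive: `(y s)² = b^(-x-r)` and `y² = b^x a^(2x) u^(2j)`. An even `n`
removes them. -/
theorem mul_refl_pow_of_odd (hl : 3 ≤ l) (hi : Odd i) (x : ℤ) {j : ℤ} (hj : Odd j) (n : ℕ)
    (hn : Even n) :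
    (a ^ x * u ^ j * refl k l r i) ^ (2 * n) = 1 ∧
      (a ^ x * u ^ j : ZDGroup k l) ^ (2 * n) = (a ^ x) ^ (2 * n) * (u ^ j) ^ (2 * n) := by
  have hb : ∀ z : ℤ, Commute (u ^ j : ZDGroup k l) (b ^ z) := fun z =>
    ((u_comm_b hl).zpow_left j).zpow_right z
  have hab : ∀ y z : ℤ, Commute (a ^ y : ZDGroup k l) (b ^ z) := fun y z =>
    (b_comm_a.zpow_left z).zpow_right y |>.symm
  have hbpow : ∀ z : ℤ, (b ^ z : ZDGroup k l) ^ n = 1 := fun z => by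
    rw [← zpow_natCast, ← zpow_mul, mul_comm, zpow_mul, zpow_natCast,
      b_pow_even (by omega) hn, one_zpow]
  have hu : ∀ z : ℤ, (u ^ j : ZDGroup k l) * a ^ z = b ^ z * a ^ z * u ^ j := fun z =>
    mul_inv_eq_iff_eq_mul.1 (conj_u_odd hl hj z)
  have hu' : ∀ z : ℤ, (u ^ (-j) : ZDGroup k l) * a ^ z = b ^ z * a ^ z * u ^ (-j) := fun z =>
    mul_inv_eq_iff_eq_mul.1 (conj_u_odd hl hj.neg z)
  constructor
  · have h2 : (a ^ x * u ^ j * refl k l r i) ^ 2 = a ^ x * u ^ j *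
        ((refl k l r i * a ^ x * (refl k l r i)⁻¹) * (refl k l r i * u ^ j * (refl k l r i)⁻¹)) *
        (refl k l r i * refl k l r i) := by
      rw [sq]; group
    have h3 : (a ^ x * u ^ j * refl k l r i) ^ 2 = b ^ (-x) * b ^ (-r) := by
      have h4 : (a ^ r * u ^ (-j) * (a ^ r)⁻¹ : ZDGroup k l) = b ^ (-r) * u ^ (-j) := by
        rw [← zpow_neg a r, mul_assoc, hu', ← mul_assoc, ← mul_assoc, (hab r (-r)).eq,
          mul_assoc _ (a ^ r), ← zpow_add, add_neg_cancel, zpow_zero, mul_one]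
      have h5 : (a ^ x * u ^ j * a ^ (-x) : ZDGroup k l) = b ^ (-x) * u ^ j := by
        rw [mul_assoc, hu, ← mul_assoc, ← mul_assoc, (hab x (-x)).eq,
          mul_assoc _ (a ^ x), ← zpow_add, add_neg_cancel, zpow_zero, mul_one]
      rw [h2, refl_conj_a r hl hi, refl_conj_u r, refl_mul_self r hl hi, mul_one, h4, ← mul_assoc,
        h5, mul_assoc, ← mul_assoc (u ^ j), (hb (-r)).eq, mul_assoc _ (u ^ j), ← zpow_add,
        add_neg_cancel, zpow_zero, mul_one]
    rw [pow_mul, h3, ((Commute.refl b).zpow_zpow _ _).mul_pow, hbpow, hbpow, one_mul]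
  · have h2 : (a ^ x * u ^ j : ZDGroup k l) ^ 2 = b ^ x * ((a ^ x) ^ 2 * (u ^ j) ^ 2) := by
      rw [sq, ← mul_assoc, mul_assoc (a ^ x), hu, ← mul_assoc, ← mul_assoc, (hab x x).eq]
      simp only [sq, mul_assoc]
    have hc : Commute (((u : ZDGroup k l) ^ j) ^ 2) ((a ^ x) ^ 2) := by
      rw [← zpow_natCast (u ^ j), ← zpow_mul]
      exact ((u_even_comm_a hl (by simp)).zpow_right x).pow_right 2
    have hc2 : Commute (b ^ x : ZDGroup k l) ((a ^ x) ^ 2 * (u ^ j) ^ 2) :=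
      (((hab x x).symm.pow_right 2).mul_right ((hb x).symm.pow_right 2))
    rw [pow_mul, h2, hc2.mul_pow, hbpow, one_mul, hc.symm.mul_pow, ← pow_mul, ← pow_mul]


/-! ### Solutions of `(y s)^m = y^m`. -/

/-- `s` has sign `-1`, so comparing signs gives `(-1)^m = 1`. -/
theorem even_of_mul_refl_pow_eq {m : ℕ}
    (y : ZDGroup k l) (hy : (y * refl k l r i) ^ m = y ^ m) : Even m := by
  have h := congrArg (sign k l) hy
  simp only [map_pow, map_mul, refl, map_zpow, sign_a, sign_u, sign_v, one_zpow, one_mul,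
    mul_pow] at h
  rcases Nat.even_or_odd m with h1 | h1
  · exact h1
  · rw [h1.neg_one_pow] at h
    have := mul_eq_left.1 h
    exact absurd this (by decide)

theorem toDihedral_zpow_mul_zpow_mul_refl_pow (x j : ℤ) (n : ℕ) :
    toDihedral k l (a ^ x * u ^ j * refl k l r i) ^ (2 * n) = 1 := by
  rw [pow_mul, sq]
  simp [refl]

theorem toDihedral_zpow_mul_zpow (x j : ℤ) :
    toDihedral k l (a ^ x * u ^ j) = toDihedral k l u ^ j := by
  simp only [map_mul, map_zpow, toDihedral_a, one_zpow, one_mul]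

/-- The dihedral quotient kills `a` and is faithful on the powers of `u`, so the two cyclic
subgroups meet trivially. -/
theorem zpow_mul_zpow_eq_one_iff (x j : ℤ) :
    (a ^ x * u ^ j : ZDGroup k l) = 1 ↔ (a ^ x : ZDGroup k l) = 1 ∧ (u ^ j : ZDGroup k l) = 1 := by
  refine ⟨fun h => ?_, fun h => by rw [h.1, h.2, one_mul]⟩
  have h1 : (u ^ j : ZDGroup k l) = 1 := by
    rw [← toDihedral_zpow_u_eq_one_iff, ← toDihedral_zpow_mul_zpow x j, h, map_one]
  rw [h1, mul_one] at h
  exact ⟨h, h1⟩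

/-- The order `k` of `u` divides `2 n j`, hence so does 4, and `j` is odd. -/
theorem even_of_zpow_u_pow_eq_one (hk : 4 ∣ k) {j : ℤ} (hj : Odd j) {n : ℕ}
    (h : (u ^ j : ZDGroup k l) ^ (2 * n) = 1) : Even n := by
  rw [← zpow_natCast, ← zpow_mul, zpow_u_eq_one_iff] at h
  have h4 : (4 : ℤ) ∣ j * (2 * n : ℕ) := (by exact_mod_cast hk : (4 : ℤ) ∣ k).trans h
  obtain ⟨c, rfl⟩ := hj
  rw [even_iff_two_dvd]
  have h5 : (2 * c + 1) * ((2 * n : ℕ) : ℤ) = 4 * (c * n) + 2 * n := by push_cast; ring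
  rw [h5] at h4
  omega

variable (i) in
-- With `m = 2n`, the power formulas cover all cases except `j` and `n` both odd. There both sides
-- fail: each would force `(u^j)^m = 1`, and so `n` even.
theorem mul_refl_pow_eq_iff (hl : 3 ≤ l) (hk : 4 ∣ k) (hi : Odd i) (x j : ℤ) {m : ℕ}
    (hm : Even m) :
    (a ^ x * u ^ j * refl k l r i) ^ m = (a ^ x * u ^ j) ^ m ↔
      (a ^ x : ZDGroup k l) ^ m = 1 ∧ (u ^ j : ZDGroup k l) ^ m = 1 := by
  obtain ⟨n, rfl⟩ := even_iff_two_dvd.1 hm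
  have key : (Even j ∨ Even n) → ((a ^ x * u ^ j * refl k l r i) ^ (2 * n) =
      (a ^ x * u ^ j) ^ (2 * n) ↔
      (a ^ x : ZDGroup k l) ^ (2 * n) = 1 ∧ (u ^ j : ZDGroup k l) ^ (2 * n) = 1) := by
    intro h
    have h1 : (a ^ x * u ^ j * refl k l r i) ^ (2 * n) = 1 ∧
        (a ^ x * u ^ j : ZDGroup k l) ^ (2 * n) = (a ^ x) ^ (2 * n) * (u ^ j) ^ (2 * n) := by
      rcases Int.even_or_odd j with hj | hj
      · exact mul_refl_pow_of_even r hl hi x hj n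
      · exact mul_refl_pow_of_odd r hl hi x hj n (h.resolve_left (Int.not_even_iff_odd.2 hj))
    rw [h1.1, h1.2, eq_comm]
    simp only [← zpow_natCast, ← zpow_mul]
    exact zpow_mul_zpow_eq_one_iff _ _
  rcases Int.even_or_odd j with hj | hj
  · exact key (Or.inl hj)
  · constructor
    · intro h
      -- In the dihedral quotient `y s` is a reflection, so its even power is trivial and `(u^j)^m =
      -- 1` follows.
      have h1 := congrArg (toDihedral k l) h
      rw [map_pow, map_pow, toDihedral_zpow_mul_zpow_mul_refl_pow, toDihedral_zpow_mul_zpow,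
        ← zpow_natCast, ← zpow_mul, eq_comm, toDihedral_zpow_u_eq_one_iff, zpow_mul,
        zpow_natCast] at h1
      exact (key (Or.inr (even_of_zpow_u_pow_eq_one hk hj h1))).1 h
    · intro h
      exact (key (Or.inr (even_of_zpow_u_pow_eq_one hk hj h.2))).2 h

theorem exists_zpow_u_mul_zpow_a (hl : 3 ≤ l) (j x : ℤ) :
    ∃ c : ℤ, (u ^ j * a ^ x : ZDGroup k l) = a ^ c * u ^ j := by
  rcases Int.even_or_odd j with hj | hj
  · exact ⟨x, ((u_even_comm_a hl hj).zpow_right x).eq⟩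
  · refine ⟨(2 ^ (l - 1) : ℕ) * x + x, ?_⟩
    rw [mul_inv_eq_iff_eq_mul.1 (conj_u_odd hl hj x), b, zpow_add, zpow_mul, zpow_natCast]

variable (i) in
theorem exists_eq_or_eq_mul_refl [NeZero k] (hl : 3 ≤ l) (y : ZDGroup k l) :
    ∃ x j : ℤ, y = a ^ x * u ^ j ∨ y = a ^ x * u ^ j * refl k l r i := by
  obtain ⟨x, j, z, rfl⟩ := exists_normal_form y
  rcases Int.even_or_odd z with ⟨c, rfl⟩ | ⟨c, rfl⟩
  · refine ⟨x, j, Or.inl ?_⟩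
    rw [← two_mul, zpow_mul, zpow_ofNat, v_sq, one_zpow, mul_one]
  -- Solving `s = a^r u^i v` for `v` gives `u^j v = u^(j-i) a^(-r) s`.
  · obtain ⟨d, hd⟩ := exists_zpow_u_mul_zpow_a (k := k) hl (j - i) (-r)
    refine ⟨x + d, j - i, Or.inr ?_⟩
    rw [zpow_add v, zpow_mul, zpow_ofNat, v_sq, one_zpow, one_mul, zpow_one, zpow_add, mul_assoc,
      mul_assoc (a ^ x), ← hd, refl]
    simp only [mul_assoc]
    congr 1
    rw [← mul_assoc (a ^ (-r)), ← zpow_add, neg_add_cancel, zpow_zero, one_mul, ← mul_assoc (u ^ _),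
      ← zpow_add, sub_add_cancel]

theorem pow_eq_one_of_mul_refl_pow_eq [NeZero k] (hl : 3 ≤ l) (hk : 4 ∣ k) (hi : Odd i) {m : ℕ}
    (y : ZDGroup k l) (hy : (y * refl k l r i) ^ m = y ^ m) : y ^ m = 1 := by
  have hm := even_of_mul_refl_pow_eq r y hy
  have aux : ∀ x j : ℤ, (a ^ x * u ^ j * refl k l r i) ^ m = (a ^ x * u ^ j) ^ m →
      (a ^ x * u ^ j : ZDGroup k l) ^ m = 1 := by
    intro x j h
    obtain ⟨h1, h2⟩ := (mul_refl_pow_eq_iff r i hl hk hi x j hm).1 h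
    obtain ⟨n, rfl⟩ := even_iff_two_dvd.1 hm
    rcases Int.even_or_odd j with hj | hj
    · rw [(mul_refl_pow_of_even r hl hi x hj n).2, h1, h2, one_mul]
    · rw [(mul_refl_pow_of_odd r hl hi x hj n (even_of_zpow_u_pow_eq_one hk hj h2)).2, h1, h2,
        one_mul]
  obtain ⟨x, j, rfl | rfl⟩ := exists_eq_or_eq_mul_refl r i hl y
  · exact aux x j hy
  -- As `s² = 1`, replacing `y` by `y s` interchanges the two sides of the equation.
  · rw [mul_assoc, refl_mul_self r hl hi, mul_one] at hy
    rw [← hy]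
    exact aux x j hy.symm

/-- The number of elements `y` with `(y t) ^ m = y ^ m` for `t = a ^ r u ^ i v`. -/
theorem card_mul_refl_pow_eq [NeZero k] (hl : 3 ≤ l) (hk : 4 ∣ k) (hi : Odd i) {m : ℕ}
    (hm : Even m) : Nat.card {y : ZDGroup k l // (y * refl k l r i) ^ m = y ^ m} =
      2 * (Nat.gcd m k * Nat.gcd m (2 ^ l)) := by
  have hz : ∀ (p : {p : Subgroup.zpowers (a : ZDGroup k l) // p ^ m = 1})
      (q : {q : Subgroup.zpowers (u : ZDGroup k l) // q ^ m = 1}),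
      ∃ x j : ℤ, (p.1 : ZDGroup k l) = a ^ x ∧ (q.1 : ZDGroup k l) = u ^ j ∧
        (a ^ x : ZDGroup k l) ^ m = 1 ∧ (u ^ j : ZDGroup k l) ^ m = 1 := by
    rintro ⟨⟨_, x, rfl⟩, hp⟩ ⟨⟨_, j, rfl⟩, hq⟩
    exact ⟨x, j, rfl, rfl, congrArg Subtype.val hp, congrArg Subtype.val hq⟩
  have hsol : ∀ (p : {p : Subgroup.zpowers (a : ZDGroup k l) // p ^ m = 1})
      (q : {q : Subgroup.zpowers (u : ZDGroup k l) // q ^ m = 1}) (z : Bool),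
      ((p.1 : ZDGroup k l) * q.1 * (if z then refl k l r i else 1) * refl k l r i) ^ m =
        ((p.1 : ZDGroup k l) * q.1 * (if z then refl k l r i else 1)) ^ m := by
    intro p q z
    obtain ⟨x, j, hp, hq, h1, h2⟩ := hz p q
    have h := (mul_refl_pow_eq_iff r i hl hk hi x j hm).2 ⟨h1, h2⟩
    rw [hp, hq]
    cases z
    · simpa using h
    · simpa [mul_assoc _ (refl k l r i), refl_mul_self r hl hi] using h.symm
  -- The solutions are parametrized as `p q` or `p q s`. The sign recovers the last choice; trivial
  -- intersection of the cyclic subgroups recovers `p` and `q`.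
  let F : {p : Subgroup.zpowers (a : ZDGroup k l) // p ^ m = 1} ×
      {q : Subgroup.zpowers (u : ZDGroup k l) // q ^ m = 1} × Bool →
      {y : ZDGroup k l // (y * refl k l r i) ^ m = y ^ m} :=
    fun x => ⟨_, hsol x.1 x.2.1 x.2.2⟩
  have hF : Function.Bijective F := by
    constructor
    · rintro ⟨p, q, z⟩ ⟨p', q', z'⟩ h
      have h0 : (p.1 : ZDGroup k l) * q.1 * (if z then refl k l r i else 1) =
        (p'.1 : ZDGroup k l) * q'.1 * (if z' then refl k l r i else 1) := congrArg Subtype.val h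
      obtain ⟨x, j, hp, hq, -, -⟩ := hz p q
      obtain ⟨x', j', hp', hq', -, -⟩ := hz p' q'
      have hzz : z = z' := by
        have h1 := congrArg (sign k l) h0
        rw [hp, hq, hp', hq'] at h1
        simp only [map_mul, map_zpow, sign_a, sign_u, one_zpow, one_mul] at h1
        cases z <;> cases z' <;> first | rfl | (simp [refl] at h1)
      subst hzz
      have h1 := mul_right_cancel h0
      rw [hp, hq, hp', hq'] at h1
      have h2 : (a ^ (-x' + x) * u ^ (j - j') : ZDGroup k l) = 1 := by
        rw [zpow_add, zpow_sub, mul_assoc, ← mul_assoc (a ^ x), h1, zpow_neg, mul_assoc (a ^ x'),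
          mul_inv_cancel, mul_one, inv_mul_cancel]
      obtain ⟨h3, h4⟩ := (zpow_mul_zpow_eq_one_iff _ _).1 h2
      rw [zpow_add, zpow_neg, inv_mul_eq_one, ← hp, ← hp'] at h3
      rw [zpow_sub, mul_inv_eq_one, ← hq, ← hq'] at h4
      rw [Subtype.ext (Subtype.ext h3.symm), Subtype.ext (Subtype.ext h4)]
    · rintro ⟨y, hy⟩
      obtain ⟨x, j, rfl | rfl⟩ := exists_eq_or_eq_mul_refl r i hl y
      · obtain ⟨h1, h2⟩ := (mul_refl_pow_eq_iff r i hl hk hi x j hm).1 hy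
        exact ⟨⟨⟨⟨_, x, rfl⟩, Subtype.ext h1⟩, ⟨⟨_, j, rfl⟩, Subtype.ext h2⟩, false⟩,
          Subtype.ext (by simp [F])⟩
      · have hy' := hy
        rw [mul_assoc, refl_mul_self r hl hi, mul_one] at hy'
        obtain ⟨h1, h2⟩ := (mul_refl_pow_eq_iff r i hl hk hi x j hm).1 hy'.symm
        exact ⟨⟨⟨⟨_, x, rfl⟩, Subtype.ext h1⟩, ⟨⟨_, j, rfl⟩, Subtype.ext h2⟩, true⟩,
          Subtype.ext (by simp [F])⟩
  rw [← Nat.card_congr (Equiv.ofBijective F hF), Nat.card_prod, Nat.card_prod,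
    card_zpowers_pow_eq_one, card_zpowers_pow_eq_one, orderOf_u,
    orderOf_a (by omega) (Dvd.dvd.trans (by norm_num) hk), Nat.card_eq_fintype_card (α := Bool),
    Fintype.card_bool, Nat.gcd_comm m, Nat.gcd_comm m]
  ring

end Reflection

end ZDGroup

/-! ### The dimension, irreducibility and indicators of `V`. -/

theorem mainTheorem10 (k l : ℕ) [NeZero k] (hl : 3 ≤ l) (hk : 4 ∣ k)
    (r i : ℤ) (hi : Odd i) (s : ZDGroup k l) (hs : s = ZDGroup.a ^ r * ZDGroup.u ^ i * ZDGroup.v)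
    {W : Type*} [AddCommGroup W] [Module ℂ W] [FiniteDimensional ℂ W]
    (ρ : Representation ℂ (Subgroup.centralizer {s}) W) (hρ : ρ.IsIrreducible)
    (τ : ConjTransversal s) :
    Module.finrank ℂ (DoubleModule ρ τ) = 2 ^ (l - 2) * k ∧
    IsSimpleModule (DrinfeldDouble (ZDGroup k l)) (DoubleModule ρ τ) ∧
    (∀ m : ℕ, 1 ≤ m →
      indicator (DrinfeldDouble.integral (ZDGroup k l)) (DoubleModule ρ τ) m =
        if 2 ∣ m then (1 / 4 : ℂ) * (Nat.gcd m k : ℂ) * (Nat.gcd m (2 ^ l) : ℂ) else 0) ∧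
    indicator (DrinfeldDouble.integral (ZDGroup k l)) (DoubleModule ρ τ) 2 = 1 := by
  have hs' : s = ZDGroup.refl k l r i := hs
  have hss : s * s = 1 := hs' ▸ ZDGroup.refl_mul_self r hl hi
  have hcount : ∀ m : ℕ, Even m → Nat.card {y : ZDGroup k l // (y * s) ^ m = y ^ m} =
      2 * (Nat.gcd m k * Nat.gcd m (2 ^ l)) := fun m hm =>
    hs' ▸ ZDGroup.card_mul_refl_pow_eq r hl hk hi hm
  have hone : ∀ (m : ℕ) (y : ZDGroup k l), (y * s) ^ m = y ^ m → y ^ m = 1 := fun m y hy =>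
    ZDGroup.pow_eq_one_of_mul_refl_pow_eq r hl hk hi y (hs' ▸ hy)
  have heven : ∀ (m : ℕ) (y : ZDGroup k l), (y * s) ^ m = y ^ m → Even m := fun m y hy =>
    ZDGroup.even_of_mul_refl_pow_eq (i := i) r y (hs' ▸ hy)
  have hgk : Nat.gcd 2 k = 2 := Nat.gcd_eq_left (Dvd.dvd.trans (by norm_num) hk)
  have hgl : Nat.gcd 2 (2 ^ l) = 2 := Nat.gcd_eq_left (dvd_pow_self 2 (by omega))
  -- Cancelling `y` leaves `s y s = y`, which is commutation because `s² = 1`. The case `m = 2` thus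
  -- describes the centralizer.
  have hmem : ∀ y : ZDGroup k l, y ∈ Subgroup.centralizer {s} ↔ (y * s) ^ 2 = y ^ 2 := by
    intro y
    rw [Subgroup.mem_centralizer_singleton_iff, sq, sq, mul_assoc, mul_right_inj, ← mul_assoc]
    constructor
    · intro h
      rw [← h, mul_assoc, hss, mul_one]
    · intro h
      conv_lhs => rw [← h]
      rw [mul_assoc, hss, mul_one]
  have hcard : Nat.card (Subgroup.centralizer {s}) = 8 := by
    rw [Nat.card_congr (Equiv.subtypeEquivRight hmem),
      hcount 2 even_two, hgk, hgl]
  have hG : Nat.card (ZDGroup k l) = 2 * (k * 2 ^ l) := by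
    -- For `m = 0` every `y` is a solution and `gcd(0, n) = n`, so the count is the order of the
    -- group.
    have h := hcount 0 Even.zero
    rw [Nat.gcd_zero_left, Nat.gcd_zero_left] at h
    rw [← h]
    exact Nat.card_congr (Equiv.subtypeUnivEquiv fun y => by simp).symm
  have hcomm : IsMulCommutative (Subgroup.centralizer {s}) := by
    -- Centralizer elements solve the equation for `m = 2`, so their squares are trivial, and a
    -- group of exponent 2 is abelian.
    have hexp : ∀ y : Subgroup.centralizer {s}, y * y = 1 := fun y => Subtype.ext (by
      rw [Subgroup.coe_mul, ← sq]
      exact hone 2 _ ((hmem _).1 y.2))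
    refine ⟨⟨fun x y => ?_⟩⟩
    have h1 : ∀ y : Subgroup.centralizer {s}, y⁻¹ = y := fun y =>
      inv_eq_of_mul_eq_one_left (hexp y)
    rw [← h1 (x * y), mul_inv_rev, h1, h1]
  have hW : Module.finrank ℂ W = 1 :=
    Representation.IsIrreducible.finrank_eq_one_of_isMulCommutative ρ
  have hind : ∀ m : ℕ, indicator (DrinfeldDouble.integral (ZDGroup k l)) (DoubleModule ρ τ) m =
      if 2 ∣ m then (1 / 4 : ℂ) * (Nat.gcd m k : ℂ) * (Nat.gcd m (2 ^ l) : ℂ) else 0 := by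
    intro m
    rw [indicator_doubleModule ρ τ m (hone m), hcard, hW]
    split_ifs with hm
    · rw [hcount m (even_iff_two_dvd.2 hm)]
      push_cast
      ring
    · have : IsEmpty {y : ZDGroup k l // (y * s) ^ m = y ^ m} :=
        ⟨fun y => hm (even_iff_two_dvd.1 (heven m y.1 y.2))⟩
      simp
  refine ⟨?_, DoubleModule.isSimpleModule_of_finrank_eq_one ρ τ hW, fun m _ => hind m, ?_⟩
  · rw [DoubleModule.finrank_eq, hW, mul_one]
    have h := card_conjClass_mul_card_centralizer s
    -- Writing `l = 3 + n` exposes the factor `2^3` that cancels `|C(s)| = 8`.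
    obtain ⟨n, rfl⟩ := Nat.exists_eq_add_of_le hl
    rw [hcard, hG, pow_add] at h
    rw [show 3 + n - 2 = n + 1 by omega, pow_succ]
    linarith
  · rw [hind, if_pos dvd_rfl, hgk, hgl]
    norm_num
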